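/- Let $\mathbb K\in\{\mathbb R,\mathbb C\}$, let $a<b$ be real numbers with $b-a=1$, let $d\in\mathbb N=\{1,2,\dots\}$ and $r\in\mathbb N\cup\{\infty\}$. Let $H^r([a,b])$ be the Hilbert space of all $f\in L^2([a,b])$ ($\mathbb K$-valued) whose weak derivatives $f^{(l)}$, $0\le l\le r$ (all $l\in\mathbb N_0$ if $r=\infty$), lie in $L^2([a,b])$ and satisfy $\sum_{l=0}^r\|f^{(l)}\|_{L^2}^2<\infty$, with the scalar product $\langle f,g\rangle_r=\sum_{l=0}^r\int_a^b f^{(l)}\,\overline{g^{(l)}}\,dx$. Let $H^r_{\rm mix}([a,b]^d)$ be its $d$-th Hilbert space tensor product, that is, the closure of the linear span of the functions $x\mapsto g_1(x_1)\cdots g_d(x_d)$, $g_i\in H^r([a,b])$, with respect to the norm $$\|f\|^2=\sum_{\alpha\in\{0,\dots,r\}^d}\|\mathrm D^\alpha f\|^2_{L^2([a,b]^d)}\qquad(\alpha\in\mathbb N_0^d\text{ if } r=\infty),$$ and let $F_d^r$ be its closed unit ball. A deterministic algorithm $A\colon F_d^r\to L^2([a,b]^d)$ based on linear information is a mapping $A=\phi\circ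 N$, where $N(f)=(y_1,\dots,y_{n(f)})$ consists of finitely many (possibly adaptively chosen) measurements $y_i=L_i(f;y_1,\dots,y_{i-1})$ with each $L_i(\cdot\,;y)$ a continuous $\mathbb K$-linear functional on $H^r_{\rm mix}([a,b]^d)$, where a termination rule depending only on the information collected so far determines $n(f)\in\mathbb N_0$, and where $\phi$ is an arbitrary mapping. The cost of $A$ is the minimum of $\sup_{f\in F_d^r}n(f)$ over all such representations, and its error is $\sup_{f\in F_d^r}\|f-A(f)\|_{L^2}$. For $n\in\mathbb N_0$ let $e(n,\mathcal P_d^r)$ be the infimum of the errors of all algorithms with cost at most $n$. Then for every $n\in\mathbb N_0$, $$e(n,\mathcal P_d^r)\le\Big(\frac{2}{n+1}\Big)^{c(d)}\qquad\text{with}\qquad c(d)=\frac{1.1929}{2+\ln d}.$$ Conversely, for every $n\in\mathbb N$ with $d\le n<2^d$, $$e(n,\mathcal P_d^r)\ge 0.27\,(n+1)^{-c(d,n+1)}\qquad\text{with}\qquad c(d,m)=\frac{1.2825}{\ln\big(1+\frac{2d}{\log_2 m}\big)},$$ and $c(d,n+1)\le 1.17$ for these $n$. -/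

import Mathlib

open MeasureTheory
open scoped ENNReal ContDiff

noncomputable section

namespace MixedSobolev

/-! ### The cube, its Lebesgue measure and weak partial derivatives -/

/-- The open cube `(a,b)^d`. -/
def openCube (a b : ℝ) (d : ℕ) : Set (Fin d → ℝ) :=
  Set.univ.pi fun _ => Set.Ioo a b

/-- Lebesgue measure on the cube `[a,b]^d`. -/
def cubeMeasure (a b : ℝ) (d : ℕ) : Measure (Fin d → ℝ) :=
  volume.restrict (Set.univ.pi fun _ => Set.Icc a b)

/-- The Hilbert space `L²([a,b]^d)` of `𝕜`-valued functions. -/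
abbrev L2Cube (𝕜 : Type*) [RCLike 𝕜] (a b : ℝ) (d : ℕ) : Type _ :=
  Lp 𝕜 2 (cubeMeasure a b d)

/-- Test functions: smooth, with compact support contained in the open cube. -/
structure IsTestFunction (a b : ℝ) (d : ℕ) (φ : (Fin d → ℝ) → ℝ) : Prop where
  contDiff : ContDiff ℝ ∞ φ
  hasCompactSupport : HasCompactSupport φ
  tsupport_subset : tsupport φ ⊆ openCube a b d

/-- The classical partial derivative `∂φ/∂x_i`. -/
def partialDeriv {d : ℕ} (i : Fin d) (φ : (Fin d → ℝ) → ℝ) (x : Fin d → ℝ) : ℝ :=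
  fderiv ℝ φ x (Pi.single i 1)

/-- `g` is the weak partial derivative of `f` in direction `x_i` on the cube. -/
def HasWeakPartialDeriv {𝕜 : Type*} [RCLike 𝕜] {a b : ℝ} {d : ℕ} (i : Fin d)
    (f g : L2Cube 𝕜 a b d) : Prop :=
  ∀ φ : (Fin d → ℝ) → ℝ, IsTestFunction a b d φ →
    ∫ x, φ x • g x ∂(cubeMeasure a b d) = -∫ x, partialDeriv i φ x • f x ∂(cubeMeasure a b d)

theorem IsTestFunction.continuous_partialDeriv {a b : ℝ} {d : ℕ} {φ : (Fin d → ℝ) → ℝ}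
    (hφ : IsTestFunction a b d φ) (i : Fin d) : Continuous (partialDeriv i φ) :=
  (hφ.contDiff.continuous_fderiv (by simp)).clm_apply continuous_const

theorem IsTestFunction.hasCompactSupport_partialDeriv {a b : ℝ} {d : ℕ} {φ : (Fin d → ℝ) → ℝ}
    (hφ : IsTestFunction a b d φ) (i : Fin d) : HasCompactSupport (partialDeriv i φ) :=
  hφ.hasCompactSupport.fderiv_apply (𝕜 := ℝ) (Pi.single i 1)

instance isFiniteMeasure_cubeMeasure (a b : ℝ) (d : ℕ) :
    IsFiniteMeasure (cubeMeasure a b d) := by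
  refine isFiniteMeasure_restrict.2 ?_
  exact (isCompact_univ_pi fun _ => isCompact_Icc).measure_lt_top.ne

theorem integrable_smul_L2 {𝕜 : Type*} [RCLike 𝕜] {a b : ℝ} {d : ℕ} {ψ : (Fin d → ℝ) → ℝ}
    (hc : Continuous ψ) (hs : HasCompactSupport ψ) (f : L2Cube 𝕜 a b d) :
    Integrable (fun x => ψ x • f x) (cubeMeasure a b d) := by
  obtain ⟨C, hC⟩ := hs.exists_bound_of_continuous hc
  exact ((Lp.memLp f).integrable (by norm_num)).bdd_smul C hc.aestronglyMeasurable
    (Filter.Eventually.of_forall hC)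

theorem HasWeakPartialDeriv.zero {𝕜 : Type*} [RCLike 𝕜] {a b : ℝ} {d : ℕ} (i : Fin d) :
    HasWeakPartialDeriv i (0 : L2Cube 𝕜 a b d) 0 := by
  intro φ _
  have h : ∀ ψ : (Fin d → ℝ) → ℝ,
      ∫ x, ψ x • (0 : L2Cube 𝕜 a b d) x ∂(cubeMeasure a b d) = 0 := by
    intro ψ
    apply integral_eq_zero_of_ae
    filter_upwards [Lp.coeFn_zero 𝕜 2 (cubeMeasure a b d)] with x hx
    rw [hx, Pi.zero_apply, smul_zero]
  rw [h, h, neg_zero]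

theorem HasWeakPartialDeriv.add {𝕜 : Type*} [RCLike 𝕜] {a b : ℝ} {d : ℕ} {i : Fin d}
    {f g f' g' : L2Cube 𝕜 a b d} (h : HasWeakPartialDeriv i f g)
    (h' : HasWeakPartialDeriv i f' g') : HasWeakPartialDeriv i (f + f') (g + g') := by
  intro φ hφ
  have key : ∀ ψ : (Fin d → ℝ) → ℝ, Continuous ψ → HasCompactSupport ψ →
      ∀ u v : L2Cube 𝕜 a b d, ∫ x, ψ x • (u + v : L2Cube 𝕜 a b d) x ∂(cubeMeasure a b d) =
        ∫ x, ψ x • u x ∂(cubeMeasure a b d) + ∫ x, ψ x • v x ∂(cubeMeasure a b d) := by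
    intro ψ hc hs u v
    rw [← integral_add (integrable_smul_L2 hc hs u) (integrable_smul_L2 hc hs v)]
    apply integral_congr_ae
    filter_upwards [Lp.coeFn_add u v] with x hx
    rw [hx, Pi.add_apply, smul_add]
  rw [key φ hφ.contDiff.continuous hφ.hasCompactSupport,
    key _ (hφ.continuous_partialDeriv i) (hφ.hasCompactSupport_partialDeriv i), h φ hφ, h' φ hφ,
    neg_add]

theorem HasWeakPartialDeriv.smul {𝕜 : Type*} [RCLike 𝕜] {a b : ℝ} {d : ℕ} {i : Fin d}
    (c : 𝕜) {f g : L2Cube 𝕜 a b d} (h : HasWeakPartialDeriv i f g) :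
    HasWeakPartialDeriv i (c • f) (c • g) := by
  intro φ hφ
  have key : ∀ (ψ : (Fin d → ℝ) → ℝ) (u : L2Cube 𝕜 a b d),
      ∫ x, ψ x • (c • u : L2Cube 𝕜 a b d) x ∂(cubeMeasure a b d) =
        c • ∫ x, ψ x • u x ∂(cubeMeasure a b d) := by
    intro ψ u
    rw [← integral_smul]
    apply integral_congr_ae
    filter_upwards [Lp.coeFn_smul c u] with x hx
    simp only [hx, Pi.smul_apply]
    exact smul_comm _ _ _
  rw [key, key, h φ hφ, smul_neg]

/-! ### Sobolev spaces -/

/-- The multi-indices `α ∈ {0,…,r}^d` (respectively `α ∈ ℕ₀^d` if `r = ∞`). -/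
def MultiIndex (d : ℕ) (r : ℕ∞) : Type :=
  {α : Fin d → ℕ // ∀ i, (α i : ℕ∞) ≤ r}

/-- The multi-index `(0,…,0)`. -/
def MultiIndex.zero (d : ℕ) (r : ℕ∞) : MultiIndex d r :=
  ⟨0, fun _ => by simp⟩

/-- The Hilbert space of square-summable families `(u_α)_{α ∈ {0,…,r}^d}` in `L²([a,b]^d)`,
with the scalar product `⟨u, v⟩ = ∑_α ⟨u_α, v_α⟩_{L²}`. -/
abbrev JetSpace (𝕜 : Type*) [RCLike 𝕜] (a b : ℝ) (d : ℕ) (r : ℕ∞) : Type _ :=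
  lp (fun _ : MultiIndex d r => L2Cube 𝕜 a b d) 2

/-- The space of all `f ∈ L²([a,b]^d)` whose weak derivatives `D^α f`, `α ∈ {0,…,r}^d`, exist in
`L²([a,b]^d)` and satisfy `∑_α ‖D^α f‖² < ∞`, with the scalar product
`⟨f, g⟩_r = ∑_α ⟨D^α f, D^α g⟩_{L²}`.

A function `f` is represented by the family `u = (D^α f)_α` (which it determines);
`f` itself is the entry `u_0`. The condition `u_α = D^α u_0` for all `α` is expressed by requiring
that `u_{α + e_i}` be the weak partial derivative of `u_α` in direction `x_i`. -/
def weakSobolev (𝕜 : Type*) [RCLike 𝕜] (a b : ℝ) (d : ℕ) (r : ℕ∞) :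
    Submodule 𝕜 (JetSpace 𝕜 a b d r) where
  carrier := {u | ∀ (α β : MultiIndex d r) (i : Fin d), β.1 = α.1 + Pi.single i 1 →
    HasWeakPartialDeriv i (u α) (u β)}
  zero_mem' := fun _ _ i _ => HasWeakPartialDeriv.zero i
  add_mem' := fun hu hv α β i h => (hu α β i h).add (hv α β i h)
  smul_mem' := fun c _ hu α β i h => (hu α β i h).smul c

/-- The function in `L²([a,b]^d)` underlying an element of the Sobolev space. -/
def weakSobolev.toL2 {𝕜 : Type*} [RCLike 𝕜] {a b : ℝ} {d : ℕ} {r : ℕ∞}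
    (u : weakSobolev 𝕜 a b d r) : L2Cube 𝕜 a b d :=
  u.1 (MultiIndex.zero d r)

/-- The univariate Sobolev space `H^r([a,b])`, `r ∈ ℕ₀ ∪ {∞}`, with the scalar product
`⟨f, g⟩_r = ∑_{l=0}^r ⟨f^{(l)}, g^{(l)}⟩_{L²}`; points of `[a,b]` are written as points of
`[a,b]^1`. -/
abbrev univariateSobolev (𝕜 : Type*) [RCLike 𝕜] (a b : ℝ) (r : ℕ∞) :
    Submodule 𝕜 (JetSpace 𝕜 a b 1 r) :=
  weakSobolev 𝕜 a b 1 r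

/-- The elementary tensors: functions of the form `f(x) = g_1(x_1) ⋯ g_d(x_d)` (almost everywhere)
with `g_1, …, g_d ∈ H^r([a,b])`. -/
def elementaryTensors (𝕜 : Type*) [RCLike 𝕜] (a b : ℝ) (d : ℕ) (r : ℕ∞) :
    Set (weakSobolev 𝕜 a b d r) :=
  {u | ∃ g : Fin d → univariateSobolev 𝕜 a b r,
    (fun x => weakSobolev.toL2 u x) =ᵐ[cubeMeasure a b d]
      fun x => ∏ i, weakSobolev.toL2 (g i) (fun _ => x i)}

/-- The space `H^r_mix([a,b]^d)`: the `d`-th tensor product of the Hilbert space `H^r([a,b])`,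
that is, the smallest Hilbert space of functions on `[a,b]^d` which contains all elementary tensors
and satisfies `⟨g_1 ⊗ ⋯ ⊗ g_d, h_1 ⊗ ⋯ ⊗ h_d⟩ = ⟨g_1, h_1⟩_r ⋯ ⟨g_d, h_d⟩_r`. It is the closure of
the span of the elementary tensors with respect to the norm
`‖f‖² = ∑_{α ∈ {0,…,r}^d} ‖D^α f‖²`, which is multiplicative on elementary tensors. -/
def mixedSobolev (𝕜 : Type*) [RCLike 𝕜] (a b : ℝ) (d : ℕ) (r : ℕ∞) :
    Submodule 𝕜 (weakSobolev 𝕜 a b d r) :=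
  (Submodule.span 𝕜 (elementaryTensors 𝕜 a b d r)).topologicalClosure

/-- The embedding `APP : H^r_mix([a,b]^d) → L²([a,b]^d)`. -/
def APP (𝕜 : Type*) [RCLike 𝕜] (a b : ℝ) (d : ℕ) (r : ℕ∞) (f : mixedSobolev 𝕜 a b d r) :
    L2Cube 𝕜 a b d :=
  weakSobolev.toL2 f.1

/-! ### Deterministic algorithms based on linear information -/

/-- The result `(y_1,…,y_k)` of the first `k` adaptive measurements of the input `f`, where
`y_{k+1} = L_{k+1}(f; y_1,…,y_k)` and the functional `L_{k+1}(·; y)` is `L y`. -/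
def firstData {𝕜 : Type*} [RCLike 𝕜] {H : Type*} [NormedAddCommGroup H] [NormedSpace 𝕜 H]
    (L : List 𝕜 → (H →L[𝕜] 𝕜)) (f : H) : ℕ → List 𝕜
  | 0 => []
  | k + 1 => firstData L f k ++ [L (firstData L f k) f]

/-- A (possibly adaptive) information mapping on `F`, based on the class `Λ^all` of all continuous
linear functionals. If `y = (y_1,…,y_k)` is the information collected so far, then `halts y` decides
whether to terminate (possibly without any measurement), and `measurement y` is the next functional
otherwise. The process has to terminate for every input in `F`. -/
structure Information (𝕜 : Type*) [RCLike 𝕜] {H : Type*} [NormedAddCommGroup H]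
    [NormedSpace 𝕜 H] (F : Set H) where
  measurement : List 𝕜 → (H →L[𝕜] 𝕜)
  halts : List 𝕜 → Prop
  terminates : ∀ f ∈ F, ∃ k, halts (firstData measurement f k)

namespace Information

variable {𝕜 : Type*} [RCLike 𝕜] {H : Type*} [NormedAddCommGroup H] [NormedSpace 𝕜 H] {F : Set H}

/-- The number `n(f)` of measurements taken for the input `f`. -/
def count (N : Information 𝕜 F) (f : H) : ℕ :=
  sInf {k | N.halts (firstData N.measurement f k)}

/-- The information `N(f)` about the input `f`. -/
def data (N : Information 𝕜 F) (f : H) : List 𝕜 :=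
  firstData N.measurement f (N.count f)

/-- The worst case cost of the information mapping. -/
def cost (N : Information 𝕜 F) : ℕ∞ :=
  ⨆ f : F, (N.count f.1 : ℕ∞)

end Information

/-- `(φ, N)` is a representation of the mapping `A : F → G`, that is, `A = φ ∘ N`. -/
def IsRepresentation {𝕜 : Type*} [RCLike 𝕜] {H : Type*} [NormedAddCommGroup H]
    [NormedSpace 𝕜 H] {F : Set H} {G : Type*} (A : F → G) (φ : List 𝕜 → G)
    (N : Information 𝕜 F) : Prop :=
  ∀ f : F, A f = φ (N.data f.1)

/-- The class of all deterministic algorithms `A : F → G` based on `Λ^all`. -/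
def Algorithm (𝕜 : Type*) [RCLike 𝕜] {H : Type*} [NormedAddCommGroup H] [NormedSpace 𝕜 H]
    (F : Set H) (G : Type*) : Type _ :=
  {A : F → G // ∃ (φ : List 𝕜 → G) (N : Information 𝕜 F), IsRepresentation A φ N}

/-- The worst case cost of an algorithm: the smallest cost of an information mapping in a
representation of the algorithm. -/
def Algorithm.cost {𝕜 : Type*} [RCLike 𝕜] {H : Type*} [NormedAddCommGroup H] [NormedSpace 𝕜 H]
    {F : Set H} {G : Type*} (A : Algorithm 𝕜 F G) : ℕ∞ :=
  sInf {c | ∃ (φ : List 𝕜 → G) (N : Information 𝕜 F), IsRepresentation A.1 φ N ∧ c = N.cost}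

/-- The worst case error `sup_{f ∈ F} dist(S f, A f) ∈ [0,∞]` of an algorithm. -/
def Algorithm.err {𝕜 : Type*} [RCLike 𝕜] {H : Type*} [NormedAddCommGroup H] [NormedSpace 𝕜 H]
    {F : Set H} {G : Type*} [PseudoEMetricSpace G] (A : Algorithm 𝕜 F G) (S : H → G) : ℝ≥0∞ :=
  ⨆ f : F, edist (S f.1) (A.1 f)

/-- The `n`-th minimal error of the problem `P[S, F, G, Λ^all, det, wc]`: the infimum of the worst
case errors of all algorithms with cost at most `n`. -/
def minimalError (𝕜 : Type*) [RCLike 𝕜] {H : Type*} [NormedAddCommGroup H] [NormedSpace 𝕜 H]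
    {G : Type*} [PseudoEMetricSpace G] (S : H → G) (F : Set H) (n : ℕ) : ℝ≥0∞ :=
  ⨅ (A : Algorithm 𝕜 F G) (_ : A.cost ≤ n), A.err S

/-- The minimal error `e(n, P^r_d)` for the `L²`-approximation of functions from the unit ball of
`H^r_mix([a,b]^d)`. -/
def mixedMinimalError (𝕜 : Type*) [RCLike 𝕜] (a b : ℝ) (d : ℕ) (r : ℕ∞) (n : ℕ) : ℝ≥0∞ :=
  minimalError 𝕜 (APP 𝕜 a b d r) (Metric.closedBall 0 1) n

/-- The exponent `c(d) = 1.1929 / (2 + ln d)` of the upper bound. -/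
def upperExponent (d : ℕ) : ℝ :=
  1.1929 / (2 + Real.log d)

/-- The exponent `c(d,m) = 1.2825 / ln(1 + 2d / log₂ m)` of the lower bound. -/
def lowerExponent (d m : ℕ) : ℝ :=
  1.2825 / Real.log (1 + 2 * d / Real.logb 2 m)

end MixedSobolev

end

/-! Both bounds come from explicit orthogonal systems of tensor products.

Upper bound. Let `w k = 1 + (kπ)²` be `cosWeight`. Integrating by parts against products of sines
and cosines turns the Fourier coefficients of `D^α f`, `α ∈ {0,1}^d`, into multiples of the cosine
coefficients of `f`; no boundary terms arise, as the sines vanish at the endpoints. Bessel's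
inequality for each `α`, summed over `α`, gives `∑_k (∏ w (k_i)) |⟨c_k, f⟩|² ≤ ‖f‖²`
(`sum_weight_mul_sq_inner_le`). Projecting onto the cosines with `∏ w (k_i) < ε⁻²` therefore has
error at most `ε`. Their number is controlled by a Markov-type estimate: with `q = 1 / (2 c(d))`,
the sum of `∏ w (k_i)^(-q)` is at most `(1 + 0.46/d)^d ≤ 2` (`sum_cosWeight_rpow_le`).

Lower bound. Adaptive measurements of an input on which they all vanish cannot separate it from its
negative, so every subspace of dimension larger than `n` forces an error (`le_minimalError`). The
subspace is spanned by products of Legendre polynomials of degree at most two. Their derivatives of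
every order are again orthogonal, and their squared univariate norms are at most `1`, `13`, `781 ≤
13³`. It remains to count the products of squared norm at most `13^l`. Those without a quadratic
factor give partial sums of binomial coefficients; those with exactly one quadratic factor are
needed when these sums fall short near `n = 2^d`. The count is compared with `(1 + 2d / log₂ m)^l`,
`m = n + 1`, in `one_add_div_logb_pow_le_of_costCount_lt`, whose single exception `d = 3`, `m = 8`
is treated with the sharper value `781`. -/

namespace MixedSobolev

/-! ### Minimal errors: general lower and upper bounds for adaptive algorithms -/

section Abstract

variable {𝕜 : Type*} [RCLike 𝕜] {H : Type*} [NormedAddCommGroup H] [NormedSpace 𝕜 H]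

theorem firstData_eq_replicate {L : List 𝕜 → (H →L[𝕜] 𝕜)} {f : H} {n : ℕ}
    (h : ∀ k < n, L (List.replicate k 0) f = 0) :
    ∀ k ≤ n, firstData L f k = List.replicate k 0 := by
  intro k
  induction k with
  | zero => intro _; rfl
  | succ k ih =>
    intro hk
    rw [firstData, ih (by omega), h k (by omega), List.replicate_succ']

theorem length_firstData (L : List 𝕜 → (H →L[𝕜] 𝕜)) (f : H) (k : ℕ) :
    (firstData L f k).length = k := by
  induction k with
  | zero => rfl
  | succ k ih => simp [firstData, ih]

theorem getD_firstData (L : List 𝕜 → (H →L[𝕜] 𝕜)) (f : H) {i k : ℕ} (hik : i < k) :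
    (firstData L f k).getD i 0 = L (firstData L f i) f := by
  induction k with
  | zero => omega
  | succ k ih =>
    rw [firstData]
    rcases Nat.lt_succ_iff_lt_or_eq.1 hik with h | rfl
    · rw [List.getD_append _ _ _ _ (by rwa [length_firstData]), ih h]
    · rw [List.getD_append_right _ _ _ _ (by rw [length_firstData]), length_firstData]
      simp

theorem Information.halts_count {F : Set H} (N : Information 𝕜 F) {f : H} (hf : f ∈ F) :
    N.halts (firstData N.measurement f (N.count f)) :=
  Nat.sInf_mem (s := {k | N.halts (firstData N.measurement f k)}) (N.terminates f hf)

/-- Halting is decided by the collected data alone, so data that agree up to the stopping time of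
one input force the two stopping times to coincide. -/
theorem Information.data_congr {F : Set H} (N : Information 𝕜 F) {f g : H} (hf : f ∈ F)
    (hg : g ∈ F) {n : ℕ} (hn : N.count f ≤ n)
    (h : ∀ k ≤ n, firstData N.measurement f k = firstData N.measurement g k) :
    N.data f = N.data g := by
  have h1 : N.count g ≤ N.count f :=
    Nat.sInf_le (by rw [Set.mem_ofPred_eq, ← h _ hn]; exact N.halts_count hf)
  have h2 : N.count f ≤ N.count g :=
    Nat.sInf_le (by rw [Set.mem_ofPred_eq, h _ (h1.trans hn)]; exact N.halts_count hg)
  have h3 : N.count f = N.count g := le_antisymm h2 h1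
  rw [Information.data, Information.data, ← h3, h _ hn]

/-- Adaptive information of cost at most `n` cannot distinguish some `f ≠ 0` in a subspace of
dimension larger than `n` from `-f`. -/
theorem le_minimalError {G : Type*} [NormedAddCommGroup G] [NormedSpace 𝕜 G] (S : H →ₗ[𝕜] G)
    {V : Type*} [AddCommGroup V] [Module 𝕜 V] [FiniteDimensional 𝕜 V] (T : V →ₗ[𝕜] H)
    (hT : Function.Injective T) {n : ℕ} (hn : n < Module.finrank 𝕜 V) {ε : ℝ}
    (h : ∀ v, ε * ‖T v‖ ≤ ‖S (T v)‖) :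
    ENNReal.ofReal ε ≤ minimalError 𝕜 S (Metric.closedBall (0 : H) 1) n := by
  refine le_iInf₂ fun A hA => ?_
  -- The infimum defining the cost is attained, because `ℕ∞` is well-ordered.
  obtain ⟨φ, N, hrep, hcost⟩ := csInf_mem (s := {c | ∃ (φ : List 𝕜 → G)
    (N : Information 𝕜 (Metric.closedBall (0 : H) 1)), IsRepresentation A.1 φ N ∧ c = N.cost})
    (by obtain ⟨φ, N, hN⟩ := A.2; exact ⟨_, φ, N, hN, rfl⟩)
  have hN : N.cost ≤ n := by rw [← hcost]; exact hA
  have hcount : ∀ f ∈ Metric.closedBall (0 : H) 1, N.count f ≤ n := fun f hf => by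
    exact_mod_cast (le_iSup (fun f : Metric.closedBall (0 : H) 1 => (N.count f.1 : ℕ∞))
      ⟨f, hf⟩).trans hN
  -- Along the branch where every answer is zero the adaptive functionals are fixed in advance;
  -- these `n` functionals have a common nonzero kernel vector.
  obtain ⟨v, hv0, hv⟩ : ∃ v : V, v ≠ 0 ∧
      ∀ k < n, N.measurement (List.replicate k 0) (T v) = 0 := by
    let Φ : V →ₗ[𝕜] (Fin n → 𝕜) :=
      LinearMap.pi fun k => (N.measurement (List.replicate k 0)).toLinearMap ∘ₗ T
    obtain ⟨v, hv, hv0⟩ := Submodule.exists_mem_ne_zero_of_ne_bot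
      (LinearMap.ker_ne_bot_of_finrank_lt (f := Φ) (by simpa using hn))
    exact ⟨v, hv0, fun k hk => congrFun (LinearMap.mem_ker.1 hv) ⟨k, hk⟩⟩
  have hTv : T v ≠ 0 := fun h0 => hv0 (hT (h0.trans (map_zero T).symm))
  have hTn : 0 < ‖T v‖ := norm_pos_iff.2 hTv
  set c : 𝕜 := ((‖T v‖⁻¹ : ℝ) : 𝕜) with hc
  have hcn : ‖c‖ = ‖T v‖⁻¹ := by
    rw [hc, RCLike.norm_ofReal, abs_of_pos (inv_pos.2 hTn)]
  set f : H := c • T v with hf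
  have hfn : ‖f‖ = 1 := by rw [hf, norm_smul, hcn, inv_mul_cancel₀ hTn.ne']
  have hfB : f ∈ Metric.closedBall (0 : H) 1 := by simp [hfn]
  have hfB' : -f ∈ Metric.closedBall (0 : H) 1 := by simp [hfn]
  have hSf : ε ≤ ‖S f‖ := by
    rw [hf, map_smul, norm_smul, hcn, inv_mul_eq_div, le_div_iff₀ hTn]
    exact h v
  have hz : ∀ k < n, N.measurement (List.replicate k 0) f = 0 := fun k hk => by
    rw [hf, map_smul, hv k hk, smul_zero]
  have hz' : ∀ k < n, N.measurement (List.replicate k 0) (-f) = 0 := fun k hk => by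
    rw [map_neg, hz k hk, neg_zero]
  have hdata : N.data f = N.data (-f) :=
    N.data_congr hfB hfB' (hcount f hfB) fun k hk => by
      rw [firstData_eq_replicate hz k hk, firstData_eq_replicate hz' k hk]
  have hAeq : A.1 ⟨f, hfB⟩ = A.1 ⟨-f, hfB'⟩ := by
    rw [hrep, hrep]; exact congrArg φ hdata
  set g := A.1 ⟨f, hfB⟩ with hg
  have h1 : edist (S f) g ≤ A.err S :=
    le_iSup (fun f : Metric.closedBall (0 : H) 1 => edist (S f.1) (A.1 f)) ⟨f, hfB⟩
  have h2 : edist (S (-f)) g ≤ A.err S := by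
    rw [hAeq]
    exact le_iSup (fun f : Metric.closedBall (0 : H) 1 => edist (S f.1) (A.1 f)) ⟨-f, hfB'⟩
  rw [edist_dist, dist_eq_norm] at h1 h2
  have hmax : ε ≤ max ‖S f - g‖ ‖S (-f) - g‖ := by
    by_contra! hlt
    rw [max_lt_iff] at hlt
    have h3 : (2 : 𝕜) • S f = (S f - g) - (S (-f) - g) := by
      rw [map_neg, two_smul]; abel
    have h4 : 2 * ‖S f‖ ≤ ‖S f - g‖ + ‖S (-f) - g‖ := by
      have := norm_sub_le (S f - g) (S (-f) - g)
      rwa [← h3, norm_smul, RCLike.norm_ofNat] at this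
    linarith [hlt.1, hlt.2]
  rcases le_max_iff.1 hmax with h3 | h3
  · exact (ENNReal.ofReal_le_ofReal h3).trans h1
  · exact (ENNReal.ofReal_le_ofReal h3).trans h2

/-- Upper bound through a linear, nonadaptive algorithm. -/
theorem minimalError_le {G : Type*} [NormedAddCommGroup G] [NormedSpace 𝕜 G] (S : H → G)
    (F : Set H) {m n : ℕ} (hmn : m ≤ n) (s : Fin m → (H →L[𝕜] 𝕜)) (g : Fin m → G) {ε : ℝ≥0∞}
    (h : ∀ f ∈ F, edist (S f) (∑ i, s i f • g i) ≤ ε) :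
    minimalError 𝕜 S F n ≤ ε := by
  -- The length of the data serves as a counter, so the measurements do not depend on the answers.
  -- The default `0` is never reached before halting.
  let L : List 𝕜 → (H →L[𝕜] 𝕜) := fun y => if hy : y.length < m then s ⟨y.length, hy⟩ else 0
  let N : Information 𝕜 F := ⟨L, fun y => m ≤ y.length, fun f _ => ⟨m, by rw [length_firstData]⟩⟩
  let φ : List 𝕜 → G := fun y => ∑ i : Fin m, y.getD i 0 • g i
  have hcount : ∀ f, N.count f = m := fun f => by
    have : {k | N.halts (firstData N.measurement f k)} = Set.Ici m := by
      ext k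
      change m ≤ (firstData N.measurement f k).length ↔ m ≤ k
      rw [length_firstData]
    rw [Information.count, this, csInf_Ici]
  have hφ : ∀ f, φ (N.data f) = ∑ i, s i f • g i := fun f => by
    refine Finset.sum_congr rfl fun i _ => ?_
    rw [Information.data, hcount, getD_firstData _ _ i.2]
    change (if hy : (firstData L f i).length < m then s ⟨_, hy⟩ else 0) f • g i = _
    simp [length_firstData]
  let A : Algorithm 𝕜 F G := ⟨fun f => φ (N.data f.1), φ, N, fun _ => rfl⟩
  have hA : A.cost ≤ n := by
    refine (sInf_le ⟨φ, N, fun _ => rfl, rfl⟩ : A.cost ≤ N.cost).trans ?_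
    refine iSup_le fun f => ?_
    rw [hcount]
    exact_mod_cast hmn
  refine (iInf₂_le A hA).trans (iSup_le fun f => ?_)
  change edist (S f.1) (φ (N.data f.1)) ≤ ε
  rw [hφ]
  exact h f.1 f.2

end Abstract

/-! ### Tensor products of continuous functions in `L²` of the cube -/

section Tensor

variable {a b : ℝ} {d : ℕ}

/-- The tensor product `x ↦ g_1(x_1) ⋯ g_d(x_d)`. -/
def tensorProd (g : Fin d → C(ℝ, ℝ)) (x : Fin d → ℝ) : ℝ := ∏ i, g i (x i)

theorem continuous_tensorProd (g : Fin d → C(ℝ, ℝ)) : Continuous (tensorProd g) :=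
  continuous_finsetProd _ fun i _ => (g i).continuous.comp (continuous_apply i)

theorem tensorProd_mul (g h : Fin d → C(ℝ, ℝ)) (x : Fin d → ℝ) :
    tensorProd (g * h) x = tensorProd g x * tensorProd h x := by
  simp [tensorProd, Finset.prod_mul_distrib]

theorem tensorProd_update (g : Fin d → C(ℝ, ℝ)) (i : Fin d) (g' : C(ℝ, ℝ)) (x : Fin d → ℝ) :
    tensorProd (Function.update g i g') x = g' (x i) * ∏ j ∈ Finset.univ.erase i, g j (x j) := by
  rw [tensorProd, ← Finset.mul_prod_erase _ _ (Finset.mem_univ i), Function.update_self]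
  congr 1
  exact Finset.prod_congr rfl fun j hj => by
    rw [Function.update_of_ne (Finset.ne_of_mem_erase hj)]

theorem hasLineDerivAt_tensorProd {g : Fin d → C(ℝ, ℝ)} {i : Fin d} {g' : C(ℝ, ℝ)}
    {x : Fin d → ℝ} (h : HasDerivAt (g i) (g' (x i)) (x i)) :
    HasLineDerivAt ℝ (tensorProd g) (tensorProd (Function.update g i g') x) x
      (Pi.single i 1) := by
  have h1 : ∀ t : ℝ, tensorProd g (x + t • Pi.single i 1) =
      g i (x i + t) * ∏ j ∈ Finset.univ.erase i, g j (x j) := fun t => by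
    rw [tensorProd, ← Finset.mul_prod_erase _ _ (Finset.mem_univ i)]
    congr 1
    · simp
    · exact Finset.prod_congr rfl fun j hj => by
        simp [Pi.single_eq_of_ne (Finset.ne_of_mem_erase hj)]
  rw [HasLineDerivAt, funext h1, tensorProd_update]
  refine HasDerivAt.mul_const ?_ _
  have := HasDerivAt.comp_const_add (x i) (0 : ℝ) (f := g i) (f' := g' (x i)) (by simpa using h)
  exact this

theorem cubeMeasure_eq_pi (a b : ℝ) (d : ℕ) :
    cubeMeasure a b d = Measure.pi fun _ => volume.restrict (Set.Icc a b) := by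
  rw [cubeMeasure, volume_pi, Measure.restrict_pi_pi]

theorem measurableSet_cube (a b : ℝ) (d : ℕ) :
    MeasurableSet (Set.univ.pi fun _ : Fin d => Set.Icc a b) :=
  MeasurableSet.univ_pi fun _ => measurableSet_Icc

theorem memLp_of_continuous {𝕜 : Type*} [RCLike 𝕜] {f : (Fin d → ℝ) → 𝕜} (hf : Continuous f)
    (p : ℝ≥0∞) : MemLp f p (cubeMeasure a b d) := by
  obtain ⟨C, hC⟩ :=
    (isCompact_univ_pi fun _ : Fin d => isCompact_Icc (a := a) (b := b)).exists_bound_of_continuousOn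
    hf.continuousOn
  refine MemLp.of_bound hf.aestronglyMeasurable C ?_
  exact (ae_restrict_iff' (measurableSet_cube a b d)).2 (Filter.Eventually.of_forall hC)

theorem continuous_ofReal_tensorProd (𝕜 : Type*) [RCLike 𝕜] (g : Fin d → C(ℝ, ℝ)) :
    Continuous fun x => (tensorProd g x : 𝕜) :=
  RCLike.continuous_ofReal.comp (continuous_tensorProd g)

/-- The class in `L²([a,b]^d)` of a tensor product of continuous functions. -/
noncomputable def tensorL2 (𝕜 : Type*) [RCLike 𝕜] (a b : ℝ) (g : Fin d → C(ℝ, ℝ)) : L2Cube 𝕜 a b d :=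
  (memLp_of_continuous (continuous_ofReal_tensorProd 𝕜 g) 2).toLp _

variable {𝕜 : Type*} [RCLike 𝕜]

theorem coeFn_tensorL2 (g : Fin d → C(ℝ, ℝ)) :
    tensorL2 𝕜 a b g =ᵐ[cubeMeasure a b d] fun x => (tensorProd g x : 𝕜) :=
  MemLp.coeFn_toLp _

theorem inner_tensorL2 (g : Fin d → C(ℝ, ℝ)) (f : L2Cube 𝕜 a b d) :
    inner 𝕜 (tensorL2 𝕜 a b g) f = ∫ x, tensorProd g x • f x ∂(cubeMeasure a b d) := by
  rw [L2.inner_def]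
  refine integral_congr_ae ?_
  filter_upwards [coeFn_tensorL2 (𝕜 := 𝕜) (a := a) (b := b) g] with x hx
  rw [hx, RCLike.inner_apply, RCLike.conj_ofReal, RCLike.real_smul_eq_coe_mul, mul_comm]

theorem integral_tensorProd (g : Fin d → C(ℝ, ℝ)) :
    ∫ x, tensorProd g x ∂(cubeMeasure a b d) = ∏ i, ∫ t in Set.Icc a b, g i t := by
  rw [cubeMeasure_eq_pi, ← integral_fintype_prod_eq_prod (fun i t => g i t)]
  rfl

theorem integral_smul_tensorL2 (ψ : (Fin d → ℝ) → ℝ) (g : Fin d → C(ℝ, ℝ)) :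
    ∫ x, ψ x • tensorL2 𝕜 a b g x ∂(cubeMeasure a b d) =
      ((∫ x, ψ x * tensorProd g x ∂(cubeMeasure a b d) : ℝ) : 𝕜) := by
  rw [← integral_ofReal]
  refine integral_congr_ae ?_
  filter_upwards [coeFn_tensorL2 (𝕜 := 𝕜) (a := a) (b := b) g] with x hx
  rw [hx, RCLike.real_smul_eq_coe_mul, ← RCLike.ofReal_mul]

theorem inner_tensorL2_tensorL2 (g h : Fin d → C(ℝ, ℝ)) :
    inner 𝕜 (tensorL2 𝕜 a b g) (tensorL2 𝕜 a b h) =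
      ((∏ i, ∫ t in Set.Icc a b, g i t * h i t : ℝ) : 𝕜) := by
  rw [inner_tensorL2, integral_smul_tensorL2]
  simp only [← tensorProd_mul, integral_tensorProd]
  rfl

theorem norm_sq_tensorL2 (g : Fin d → C(ℝ, ℝ)) :
    ‖tensorL2 𝕜 a b g‖ ^ 2 = ∏ i, ∫ t in Set.Icc a b, g i t ^ 2 := by
  rw [← inner_self_eq_norm_sq (𝕜 := 𝕜), inner_tensorL2_tensorL2, RCLike.ofReal_re]
  simp only [sq]

theorem IsTestFunction.integral_cubeMeasure {φ : (Fin d → ℝ) → ℝ} (hφ : IsTestFunction a b d φ)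
    {h : (Fin d → ℝ) → ℝ} (hh : Function.support h ⊆ tsupport φ) :
    ∫ x, h x ∂(cubeMeasure a b d) = ∫ x, h x := by
  rw [cubeMeasure]
  refine setIntegral_eq_integral_of_forall_compl_eq_zero fun x hx => ?_
  by_contra hne
  exact hx (Set.pi_mono (fun _ _ => Set.Ioo_subset_Icc_self) (hφ.tsupport_subset (hh hne)))

/-- Test functions are supported in the open cube, so the integrals extend to the whole space, where
integration by parts has no boundary term. -/
theorem hasWeakPartialDeriv_tensorL2 {g : Fin d → C(ℝ, ℝ)} {i : Fin d} {g' : C(ℝ, ℝ)}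
    (h : ∀ t, HasDerivAt (g i) (g' t) t) :
    HasWeakPartialDeriv i (tensorL2 𝕜 a b g) (tensorL2 𝕜 a b (Function.update g i g')) := by
  intro φ hφ
  have hs : Function.support (partialDeriv i φ) ⊆ tsupport φ := fun x hx => by
    refine support_fderiv_subset ℝ (f := φ) fun h0 => hx ?_
    rw [partialDeriv, h0]; rfl
  rw [integral_smul_tensorL2, integral_smul_tensorL2, ← RCLike.ofReal_neg, hφ.integral_cubeMeasure, hφ.integral_cubeMeasure]
  · congr 1
    have hint : ∀ (ψ : (Fin d → ℝ) → ℝ) (g : Fin d → C(ℝ, ℝ)), Continuous ψ →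
        HasCompactSupport ψ → Integrable (fun x => ψ x * tensorProd g x) volume :=
      fun ψ g h1 h2 => (h1.mul (continuous_tensorProd g)).integrable_of_hasCompactSupport
        h2.mul_right
    refine integral_bilinear_hasLineDerivAt_right_eq_neg_left_of_integrable (μ := volume)
      (v := Pi.single i 1) (B := ContinuousLinearMap.mul ℝ ℝ)
      (hint _ g (hφ.continuous_partialDeriv i) (hφ.hasCompactSupport_partialDeriv i))
      (hint φ _ hφ.contDiff.continuous hφ.hasCompactSupport)
      (hint φ _ hφ.contDiff.continuous hφ.hasCompactSupport) ?_ ?_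
    · intro x _
      exact ((hφ.contDiff.differentiable (by simp)).differentiableAt.hasFDerivAt).hasLineDerivAt _
    · intro x _
      exact hasLineDerivAt_tensorProd (h _)
  · exact (Function.support_mul_subset_left _ _).trans hs
  · exact (Function.support_mul_subset_left _ _).trans subset_closure

end Tensor

/-! ### Legendre products as elements of the mixed Sobolev space -/

section PolynomialJets

variable {𝕜 : Type*} [RCLike 𝕜] {a b : ℝ} {d : ℕ} {r : ℕ∞}

theorem norm_sq_sum_smul_of_orthogonal {E : Type*} [NormedAddCommGroup E] [InnerProductSpace 𝕜 E]
    {ι : Type*} {v : ι → E} (hv : ∀ i j, i ≠ j → inner 𝕜 (v i) (v j) = 0) (c : ι → 𝕜)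
    (s : Finset ι) : ‖∑ i ∈ s, c i • v i‖ ^ 2 = ∑ i ∈ s, ‖c i‖ ^ 2 * ‖v i‖ ^ 2 := by
  classical
  induction s using Finset.induction_on with
  | empty => simp
  | insert i s hi ih =>
    rw [Finset.sum_insert hi, Finset.sum_insert hi, ← ih, ← mul_pow, ← norm_smul, sq, sq, sq]
    refine norm_add_sq_eq_norm_sq_add_norm_sq_of_inner_eq_zero (𝕜 := 𝕜) _ _ ?_
    rw [inner_sum]
    refine Finset.sum_eq_zero fun j hj => ?_
    rw [inner_smul_left, inner_smul_right, hv i j (fun h => hi (h ▸ hj)), mul_zero, mul_zero]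

/-- Only multi-indices below `N` in every entry contribute, and over this box the sum factorises. It
is an inequality because `r` may exclude part of the box; for `r = ∞` it also yields summability. -/
theorem sum_norm_sq_tensorL2_le {G : Fin d → ℕ → C(ℝ, ℝ)} {N : ℕ}
    (hN : ∀ i l, N ≤ l → G i l = 0) (s : Finset (MultiIndex d r)) :
    ∑ α ∈ s, ‖tensorL2 𝕜 a b fun i => G i (α.1 i)‖ ^ 2 ≤
      ∏ i, ∑ l ∈ Finset.range N, ∫ t in Set.Icc a b, G i l t ^ 2 := by
  classical
  have hnn : ∀ i l, 0 ≤ ∫ t in Set.Icc a b, G i l t ^ 2 :=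
    fun i l => integral_nonneg fun t => sq_nonneg _
  have h1 : ∑ α ∈ s, ‖tensorL2 𝕜 a b fun i => G i (α.1 i)‖ ^ 2 =
      ∑ β ∈ s.map (Function.Embedding.subtype _), ∏ i, ∫ t in Set.Icc a b, G i (β i) t ^ 2 := by
    refine Eq.trans ?_ (Finset.sum_map s (Function.Embedding.subtype _) _).symm
    exact Finset.sum_congr rfl fun α _ => norm_sq_tensorL2 _
  rw [h1, Finset.prod_univ_sum, ← Finset.sum_filter_ne_zero]
  refine Finset.sum_le_sum_of_subset_of_nonneg (fun β hβ => ?_)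
    fun β _ _ => Finset.prod_nonneg fun i _ => hnn _ _
  rw [Fintype.mem_piFinset]
  intro i
  rw [Finset.mem_range]
  by_contra! hle
  refine (Finset.mem_filter.1 hβ).2 (Finset.prod_eq_zero (Finset.mem_univ i) ?_)
  simp [hN i _ hle]

/-- The derivatives of the tensor product of the functions `G i 0`, if `G i l` is the `l`-th
derivative of `G i 0`, and vanishes for `l ≥ N`. -/
noncomputable def tensorJet (𝕜 : Type*) [RCLike 𝕜] (a b : ℝ) (r : ℕ∞) (G : Fin d → ℕ → C(ℝ, ℝ))
    {N : ℕ} (hN : ∀ i l, N ≤ l → G i l = 0) : JetSpace 𝕜 a b d r :=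
  ⟨fun α => tensorL2 𝕜 a b fun i => G i (α.1 i), by
    refine memℓp_gen' (C := ∏ i, ∑ l ∈ Finset.range N, ∫ t in Set.Icc a b, G i l t ^ 2)
      fun s => ?_
    simpa using sum_norm_sq_tensorL2_le (𝕜 := 𝕜) hN s⟩

theorem tensorJet_apply {G : Fin d → ℕ → C(ℝ, ℝ)} {N : ℕ} (hN : ∀ i l, N ≤ l → G i l = 0)
    (α : MultiIndex d r) :
    tensorJet 𝕜 a b r G hN α = tensorL2 𝕜 a b fun i => G i (α.1 i) := rfl

theorem norm_sq_tensorJet_le {G : Fin d → ℕ → C(ℝ, ℝ)} {N : ℕ} (hN : ∀ i l, N ≤ l → G i l = 0) :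
    ‖tensorJet 𝕜 a b r G hN‖ ^ 2 ≤
      ∏ i, ∑ l ∈ Finset.range N, ∫ t in Set.Icc a b, G i l t ^ 2 := by
  have hnn : 0 ≤ ∏ i, ∑ l ∈ Finset.range N, ∫ t in Set.Icc a b, G i l t ^ 2 :=
    Finset.prod_nonneg fun i _ => Finset.sum_nonneg fun l _ =>
      integral_nonneg fun t => sq_nonneg _
  refine (Real.le_sqrt (norm_nonneg _) hnn).1 ?_
  refine lp.norm_le_of_forall_sum_le (by norm_num) (Real.sqrt_nonneg _) fun s => ?_
  simp only [ENNReal.toReal_ofNat, Real.rpow_ofNat, Real.sq_sqrt hnn]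
  exact sum_norm_sq_tensorL2_le hN s

theorem tensorJet_mem_weakSobolev {G : Fin d → ℕ → C(ℝ, ℝ)} {N : ℕ}
    (hN : ∀ i l, N ≤ l → G i l = 0) (hG : ∀ i l t, HasDerivAt (G i l) (G i (l + 1) t) t) :
    tensorJet 𝕜 a b r G hN ∈ weakSobolev 𝕜 a b d r := by
  intro α β i hαβ
  have h : (fun j => G j (β.1 j)) =
      Function.update (fun j => G j (α.1 j)) i (G i (α.1 i + 1)) := by
    funext j
    rcases eq_or_ne j i with rfl | hj
    · simp [hαβ]
    · simp [hαβ, Function.update_of_ne hj, Pi.single_eq_of_ne hj]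
  rw [tensorJet_apply, tensorJet_apply, h]
  exact hasWeakPartialDeriv_tensorL2 (hG i _)

/-- Unit edge length makes each factor a probability measure, so the coordinate projections preserve
measure. This transfers the almost everywhere identities of the univariate factors to the cube. -/
theorem ae_cubeMeasure_of_ae_one (hab : b - a = 1) (i : Fin d) {p : (Fin 1 → ℝ) → Prop}
    (hp : ∀ᵐ y ∂(cubeMeasure a b 1), p y) : ∀ᵐ x ∂(cubeMeasure a b d), p fun _ => x i := by
  have : IsProbabilityMeasure (volume.restrict (Set.Icc a b)) :=
    ⟨by rw [Measure.restrict_apply_univ, Real.volume_Icc, hab, ENNReal.ofReal_one]⟩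
  rw [cubeMeasure_eq_pi] at hp ⊢
  have h1 := (measurePreserving_funUnique (volume.restrict (Set.Icc a b)) (Fin 1)).symm
  have h2 := measurePreserving_eval (fun _ : Fin d => volume.restrict (Set.Icc a b)) i
  exact (h1.comp h2).quasiMeasurePreserving.ae hp

/-- `tensorJet` as an element of `H^r_mix([a,b]^d)`. -/
noncomputable def mixedTensor (𝕜 : Type*) [RCLike 𝕜] (hab : b - a = 1) (r : ℕ∞)
    (G : Fin d → ℕ → C(ℝ, ℝ)) {N : ℕ} (hN : ∀ i l, N ≤ l → G i l = 0)
    (hG : ∀ i l t, HasDerivAt (G i l) (G i (l + 1) t) t) : mixedSobolev 𝕜 a b d r :=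
  ⟨⟨tensorJet 𝕜 a b r G hN, tensorJet_mem_weakSobolev hN hG⟩, by
    refine Submodule.le_topologicalClosure _ (Submodule.subset_span ?_)
    refine ⟨fun i => ⟨tensorJet 𝕜 a b r (fun _ => G i) fun _ => hN i,
      tensorJet_mem_weakSobolev (fun _ => hN i) fun _ => hG i⟩, ?_⟩
    have h1 : ∀ᵐ x ∂(cubeMeasure a b d), ∀ i : Fin d,
        tensorL2 𝕜 a b (fun _ : Fin 1 => G i 0) (fun _ => x i) = (G i 0 (x i) : 𝕜) :=
      ae_all_iff.2 fun i => ae_cubeMeasure_of_ae_one hab i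
        (p := fun y => tensorL2 𝕜 a b (fun _ : Fin 1 => G i 0) y = (G i 0 (y 0) : 𝕜)) (by
          filter_upwards [coeFn_tensorL2 (𝕜 := 𝕜) (a := a) (b := b) fun _ : Fin 1 => G i 0]
            with y hy
          rw [hy, tensorProd, Fin.prod_univ_one])
    filter_upwards [h1, coeFn_tensorL2 (𝕜 := 𝕜) (a := a) (b := b) fun i => G i 0] with x hx hx'
    change tensorL2 𝕜 a b (fun i => G i 0) x =
      ∏ i, tensorL2 𝕜 a b (fun _ : Fin 1 => G i 0) (fun _ => x i)
    rw [hx', tensorProd, RCLike.ofReal_prod]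
    exact Finset.prod_congr rfl fun i _ => (hx i).symm⟩

theorem inner_mixedTensor_eq_zero (hab : b - a = 1)
    {G G' : Fin d → ℕ → C(ℝ, ℝ)} {N : ℕ} (hN : ∀ i l, N ≤ l → G i l = 0)
    (hG : ∀ i l t, HasDerivAt (G i l) (G i (l + 1) t) t) (hN' : ∀ i l, N ≤ l → G' i l = 0)
    (hG' : ∀ i l t, HasDerivAt (G' i l) (G' i (l + 1) t) t) {i : Fin d}
    (h : ∀ l, ∫ t in Set.Icc a b, G i l t * G' i l t = 0) :
    inner 𝕜 (mixedTensor 𝕜 hab r G hN hG) (mixedTensor 𝕜 hab r G' hN' hG') = 0 := by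
  change inner 𝕜 (tensorJet 𝕜 a b r G hN) (tensorJet 𝕜 a b r G' hN') = 0
  rw [lp.inner_eq_tsum]
  refine (tsum_congr fun α => ?_).trans tsum_zero
  rw [tensorJet_apply, tensorJet_apply, inner_tensorL2_tensorL2,
    Finset.prod_eq_zero (Finset.mem_univ i) (h _), RCLike.ofReal_zero]

/-- `APP` as a linear map. -/
noncomputable def linearAPP (𝕜 : Type*) [RCLike 𝕜] (a b : ℝ) (d : ℕ) (r : ℕ∞) :
    mixedSobolev 𝕜 a b d r →ₗ[𝕜] L2Cube 𝕜 a b d where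
  toFun := APP 𝕜 a b d r
  map_add' _ _ := rfl
  map_smul' _ _ := rfl

/-- The derivatives of the first three normalised Legendre polynomials on the interval of
length one with midpoint `c`. -/
noncomputable def legendreJet (c : ℝ) : Fin 3 → ℕ → C(ℝ, ℝ)
  | 0, 0 => .const _ 1
  | 1, 0 => ⟨fun t => √12 * (t - c), by fun_prop⟩
  | 1, 1 => .const _ √12
  | 2, 0 => ⟨fun t => √180 * ((t - c) ^ 2 - 1 / 12), by fun_prop⟩
  | 2, 1 => ⟨fun t => √180 * (2 * (t - c)), by fun_prop⟩
  | 2, 2 => .const _ (√180 * 2)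
  | _, _ => 0

theorem legendreJet_eq_zero (c : ℝ) (k : Fin 3) {l : ℕ} (hl : 3 ≤ l) : legendreJet c k l = 0 := by
  obtain ⟨l, rfl⟩ := Nat.exists_eq_add_of_le' hl
  fin_cases k <;> rfl

theorem hasDerivAt_legendreJet (c : ℝ) (k : Fin 3) (l : ℕ) (t : ℝ) :
    HasDerivAt (legendreJet c k l) (legendreJet c k (l + 1) t) t := by
  have h1 : HasDerivAt (fun t : ℝ => t - c) 1 t := (hasDerivAt_id t).sub_const c
  rcases lt_or_ge l 3 with hl | hl
  · interval_cases l <;> fin_cases k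
    · exact hasDerivAt_const t (1 : ℝ)
    · simpa using! h1.const_mul √12
    · simpa using! ((h1.pow 2).sub_const (1 / 12)).const_mul √180
    · exact hasDerivAt_const t (0 : ℝ)
    · exact hasDerivAt_const t √12
    · simpa using! (h1.const_mul 2).const_mul √180
    · exact hasDerivAt_const t (0 : ℝ)
    · exact hasDerivAt_const t (0 : ℝ)
    · exact hasDerivAt_const t (√180 * 2)
  · rw [legendreJet_eq_zero c k hl, legendreJet_eq_zero c k (by omega : 3 ≤ l + 1)]
    exact hasDerivAt_const t (0 : ℝ)

theorem setIntegral_Icc_sub_midpoint (hab : b - a = 1) (F : ℝ → ℝ) :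
    ∫ t in Set.Icc a b, F (t - (a + b) / 2) = ∫ t in (-(1 / 2) : ℝ)..(1 / 2), F t := by
  rw [integral_Icc_eq_integral_Ioc, ← intervalIntegral.integral_of_le (by linarith),
    intervalIntegral.integral_comp_sub_right]
  congr 1 <;> linarith

/-- After centring the interval, each product is odd or zero, except that of the constant with the
quadratic, which has mean zero. Orthogonality at every order `l` is what makes the products
orthogonal in the Sobolev scalar product for every `r`. -/
theorem integral_legendreJet_mul (hab : b - a = 1) {k k' : Fin 3} (hk : k ≠ k') (l : ℕ) :
    ∫ t in Set.Icc a b, legendreJet ((a + b) / 2) k l t * legendreJet ((a + b) / 2) k' l t = 0 := by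
  wlog hlt : k < k' generalizing k k'
  · simpa only [mul_comm] using this hk.symm (lt_of_le_of_ne (not_lt.1 hlt) hk.symm)
  have hint : ∀ f : ℝ → ℝ, Continuous f → IntervalIntegrable f volume (-(1 / 2)) (1 / 2) :=
    fun f hf => hf.intervalIntegrable _ _
  have h1 : ∫ t in (-(1 / 2) : ℝ)..(1 / 2), 1 * (√12 * t) = 0 := by
    simp only [one_mul]
    rw [intervalIntegral.integral_const_mul, integral_id]
    norm_num
  have h2 : ∫ t in (-(1 / 2) : ℝ)..(1 / 2), 1 * (√180 * (t ^ 2 - 1 / 12)) = 0 := by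
    rw [intervalIntegral.integral_const_mul, intervalIntegral.integral_const_mul,
      intervalIntegral.integral_sub (hint _ (by fun_prop)) (hint _ (by fun_prop)), integral_pow]
    norm_num
  have h3 : ∫ t in (-(1 / 2) : ℝ)..(1 / 2), √12 * t * (√180 * (t ^ 2 - 1 / 12)) = 0 := by
    have : ∀ t : ℝ, √12 * t * (√180 * (t ^ 2 - 1 / 12)) = √12 * √180 * (t ^ 3 - 1 / 12 * t) :=
      fun t => by ring
    simp only [this]
    rw [intervalIntegral.integral_const_mul,
      intervalIntegral.integral_sub (hint _ (by fun_prop)) (hint _ (by fun_prop)), integral_pow,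
      intervalIntegral.integral_const_mul, integral_id]
    norm_num
  have h4 : ∫ t in (-(1 / 2) : ℝ)..(1 / 2), √12 * (√180 * (2 * t)) = 0 := by
    rw [intervalIntegral.integral_const_mul, intervalIntegral.integral_const_mul,
      intervalIntegral.integral_const_mul, integral_id]
    norm_num
  rcases lt_or_ge l 3 with hl | hl
  · interval_cases l <;> fin_cases k <;> fin_cases k' <;>
      first
      | exact absurd hlt (by decide)
      | exact (setIntegral_Icc_sub_midpoint hab _).trans h1
      | exact (setIntegral_Icc_sub_midpoint hab _).trans h2
      | exact (setIntegral_Icc_sub_midpoint hab _).trans h3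
      | exact (setIntegral_Icc_sub_midpoint hab _).trans h4
      | simp [legendreJet]
  · simp [legendreJet_eq_zero _ _ hl]

/-- The squared norms in `H^r([a,b])`, `r ≥ 2`, of the normalised Legendre polynomials. -/
def legendreWeight : Fin 3 → ℕ := ![1, 13, 781]

/-- The contributions of the derivatives are `13 = 1 + 12` and `781 = 1 + 60 + 720`. -/
theorem integral_legendreJet_sq (hab : b - a = 1) (k : Fin 3) :
    ∫ t in Set.Icc a b, legendreJet ((a + b) / 2) k 0 t ^ 2 = 1 ∧
    ∑ l ∈ Finset.range 3, ∫ t in Set.Icc a b, legendreJet ((a + b) / 2) k l t ^ 2 =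
      legendreWeight k := by
  have hint : ∀ f : ℝ → ℝ, Continuous f → IntervalIntegrable f volume (-(1 / 2)) (1 / 2) :=
    fun f hf => hf.intervalIntegrable _ _
  have hvol : ∀ c : ℝ, ∫ t in Set.Icc a b, c = c := fun c => by
    simp [hab, Measure.real, Real.volume_Icc]
  have h1 : ∫ t in Set.Icc a b, legendreJet ((a + b) / 2) 1 0 t ^ 2 = 1 := by
    refine (setIntegral_Icc_sub_midpoint hab fun t => (√12 * t) ^ 2).trans ?_
    simp only [mul_pow]
    rw [Real.sq_sqrt (by norm_num), intervalIntegral.integral_const_mul, integral_pow]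
    norm_num
  have h2 : ∫ t in Set.Icc a b, legendreJet ((a + b) / 2) 2 0 t ^ 2 = 1 := by
    refine (setIntegral_Icc_sub_midpoint hab fun t => (√180 * (t ^ 2 - 1 / 12)) ^ 2).trans ?_
    have : ∀ t : ℝ, (t ^ 2 - 1 / 12) ^ 2 = t ^ 4 - (1 / 6 * t ^ 2 - 1 / 144) := fun t => by ring
    simp only [mul_pow, this]
    rw [Real.sq_sqrt (by norm_num), intervalIntegral.integral_const_mul,
      intervalIntegral.integral_sub (hint _ (by fun_prop)) (hint _ (by fun_prop)),
      intervalIntegral.integral_sub (hint _ (by fun_prop)) (hint _ (by fun_prop)),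
      intervalIntegral.integral_const_mul, integral_pow, integral_pow]
    norm_num
  have h3 : ∫ t in Set.Icc a b, legendreJet ((a + b) / 2) 2 1 t ^ 2 = 60 := by
    refine (setIntegral_Icc_sub_midpoint hab fun t => (√180 * (2 * t)) ^ 2).trans ?_
    simp only [mul_pow]
    rw [Real.sq_sqrt (by norm_num), intervalIntegral.integral_const_mul,
      intervalIntegral.integral_const_mul, integral_pow]
    norm_num
  have h4 : ∫ t in Set.Icc a b, legendreJet ((a + b) / 2) 1 1 t ^ 2 = 12 := by
    refine (hvol (√12 ^ 2)).trans ?_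
    norm_num
  have h5 : ∫ t in Set.Icc a b, legendreJet ((a + b) / 2) 2 2 t ^ 2 = 720 := by
    refine (hvol ((√180 * 2) ^ 2)).trans ?_
    rw [mul_pow, Real.sq_sqrt (by norm_num)]
    norm_num
  have h6 : ∫ t in Set.Icc a b, legendreJet ((a + b) / 2) 0 0 t ^ 2 = 1 := by
    refine (hvol (1 ^ 2)).trans ?_
    norm_num
  have h7 : ∫ t in Set.Icc a b, legendreJet ((a + b) / 2) 0 1 t ^ 2 = 0 := by
    refine (hvol (0 ^ 2)).trans ?_
    norm_num
  have h8 : ∫ t in Set.Icc a b, legendreJet ((a + b) / 2) 0 2 t ^ 2 = 0 := by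
    refine (hvol (0 ^ 2)).trans ?_
    norm_num
  have h9 : ∫ t in Set.Icc a b, legendreJet ((a + b) / 2) 1 2 t ^ 2 = 0 := by
    refine (hvol (0 ^ 2)).trans ?_
    norm_num
  fin_cases k
  · refine ⟨h6, ?_⟩
    simp only [Finset.sum_range_succ, Finset.sum_range_zero, Fin.zero_eta, h6, h7, h8]
    norm_num [legendreWeight]
  · refine ⟨h1, ?_⟩
    simp only [Finset.sum_range_succ, Finset.sum_range_zero, Fin.mk_one, h1, h4, h9]
    norm_num [legendreWeight]
  · refine ⟨h2, ?_⟩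
    simp only [Finset.sum_range_succ, Finset.sum_range_zero, Fin.reduceFinMk, h2, h3, h5]
    norm_num [legendreWeight]
    rfl

/-- Orthogonal elements of the ball of radius `√C` whose images are orthonormal yield a lower
bound for the minimal error. -/
theorem le_minimalError_of_orthogonal {H G : Type*} [NormedAddCommGroup H] [InnerProductSpace 𝕜 H]
    [NormedAddCommGroup G] [InnerProductSpace 𝕜 G] (S : H →ₗ[𝕜] G) {ι : Type*} [Fintype ι]
    {U : ι → H} (hUo : ∀ i j, i ≠ j → inner 𝕜 (U i) (U j) = 0) {C : ℕ} (hU : ∀ i, ‖U i‖ ^ 2 ≤ C)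
    (hSo : ∀ i j, i ≠ j → inner 𝕜 (S (U i)) (S (U j)) = 0) (hSn : ∀ i, ‖S (U i)‖ ^ 2 = 1) {n : ℕ}
    (hn : n < Fintype.card ι) :
    ENNReal.ofReal ((√C)⁻¹) ≤ minimalError 𝕜 S (Metric.closedBall (0 : H) 1) n := by
  let T : (ι → 𝕜) →ₗ[𝕜] H := Fintype.linearCombination 𝕜 U
  have hT : ∀ v, ‖T v‖ ^ 2 ≤ C * ∑ i, ‖v i‖ ^ 2 := fun v => by
    rw [Fintype.linearCombination_apply, norm_sq_sum_smul_of_orthogonal hUo, Finset.mul_sum]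
    refine Finset.sum_le_sum fun i _ => ?_
    rw [mul_comm]
    exact mul_le_mul_of_nonneg_right (hU i) (sq_nonneg _)
  have hS : ∀ v, ‖S (T v)‖ ^ 2 = ∑ i, ‖v i‖ ^ 2 := fun v => by
    have : S (T v) = ∑ i, v i • S (U i) := by
      rw [Fintype.linearCombination_apply, map_sum]
      exact Finset.sum_congr rfl fun i _ => map_smul _ _ _
    rw [this, norm_sq_sum_smul_of_orthogonal hSo]
    simp [hSn]
  have hTinj : Function.Injective T := by
    rw [injective_iff_map_eq_zero]
    intro v hv
    have h := hS v
    rw [hv, map_zero, norm_zero, zero_pow two_ne_zero, eq_comm,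
      Finset.sum_eq_zero_iff_of_nonneg fun _ _ => sq_nonneg _] at h
    funext i
    simpa using h i (Finset.mem_univ i)
  refine le_minimalError S T hTinj (by simpa using hn) fun v => ?_
  refine abs_le_of_sq_le_sq' ?_ (norm_nonneg _) |>.2
  rw [mul_pow, inv_pow, Real.sq_sqrt (Nat.cast_nonneg C), hS]
  -- For `C = 0` the convention `0⁻¹ = 0` makes the left side vanish.
  rcases Nat.eq_zero_or_pos C with rfl | hC
  · simpa using Finset.sum_nonneg fun i _ => sq_nonneg ‖v i‖
  · rw [inv_mul_le_iff₀ (by exact_mod_cast hC)]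
    exact hT v

/-- The lower bound obtained from the tensor products of Legendre polynomials whose squared norm
is at most `C`. -/
theorem le_mixedMinimalError (hab : b - a = 1) {n C : ℕ}
    (hn : n < (Finset.univ.filter fun α : Fin d → Fin 3 =>
      ∏ i, legendreWeight (α i) ≤ C).card) :
    ENNReal.ofReal ((√C)⁻¹) ≤ mixedMinimalError 𝕜 a b d r n := by
  set I := Finset.univ.filter fun α : Fin d → Fin 3 => ∏ i, legendreWeight (α i) ≤ C with hI
  set c := (a + b) / 2 with hc
  let U : I → mixedSobolev 𝕜 a b d r := fun α =>
    mixedTensor 𝕜 hab r (fun i => legendreJet c (α.1 i))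
      (fun i l hl => legendreJet_eq_zero c (α.1 i) hl)
      fun i l t => hasDerivAt_legendreJet c (α.1 i) l t
  have hU : ∀ α, ‖U α‖ ^ 2 ≤ C := fun α => by
    have h := norm_sq_tensorJet_le (𝕜 := 𝕜) (a := a) (b := b) (r := r)
      (G := fun i => legendreJet c (α.1 i)) fun i l hl => legendreJet_eq_zero c (α.1 i) hl
    simp only [hc, (integral_legendreJet_sq hab _).2] at h
    refine h.trans ?_
    exact_mod_cast (Finset.mem_filter.1 α.2).2
  have hne : ∀ α β : I, α ≠ β → ∃ i, α.1 i ≠ β.1 i := fun α β h => by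
    by_contra! h'
    exact h (Subtype.ext (funext h'))
  have hUo : ∀ α β, α ≠ β → inner 𝕜 (U α) (U β) = 0 := fun α β h => by
    obtain ⟨i, hi⟩ := hne α β h
    exact inner_mixedTensor_eq_zero hab _ _ _ _ (i := i) fun l => integral_legendreJet_mul hab hi l
  let E : I → L2Cube 𝕜 a b d := fun α => tensorL2 𝕜 a b fun i => legendreJet c (α.1 i) 0
  have hEo : ∀ α β, α ≠ β → inner 𝕜 (E α) (E β) = 0 := fun α β h => by
    obtain ⟨i, hi⟩ := hne α β h
    rw [inner_tensorL2_tensorL2,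
      Finset.prod_eq_zero (Finset.mem_univ i) (integral_legendreJet_mul hab hi 0),
      RCLike.ofReal_zero]
  have hEn : ∀ α, ‖E α‖ ^ 2 = 1 := fun α => by
    rw [norm_sq_tensorL2]
    exact Finset.prod_eq_one fun i _ => (integral_legendreJet_sq hab _).1
  have key := @le_minimalError_of_orthogonal 𝕜 _ (mixedSobolev 𝕜 a b d r) (L2Cube 𝕜 a b d)
    inferInstance inferInstance _ _ (linearAPP 𝕜 a b d r) I _ U
  exact key hUo hU hEo hEn (by simpa using hn)

end PolynomialJets

/-! ### Weak derivatives tested against functions without compact support -/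

section Cutoff

variable {a b : ℝ} {d : ℕ}

open Filter Topology

theorem deriv_smoothTransition_of_one_lt {u : ℝ} (hu : 1 < u) :
    deriv Real.smoothTransition u = 0 := by
  have : Real.smoothTransition =ᶠ[𝓝 u] fun _ => 1 := by
    filter_upwards [lt_mem_nhds hu] with v hv using Real.smoothTransition.one_of_one_le hv.le
  rw [this.deriv_eq, deriv_const]

theorem deriv_smoothTransition_of_neg {u : ℝ} (hu : u < 0) :
    deriv Real.smoothTransition u = 0 := by
  have : Real.smoothTransition =ᶠ[𝓝 u] fun _ => 0 := by
    filter_upwards [gt_mem_nhds hu] with v hv using Real.smoothTransition.zero_of_nonpos hv.le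
  rw [this.deriv_eq, deriv_const]

theorem continuous_deriv_smoothTransition : Continuous (deriv Real.smoothTransition) :=
  (Real.smoothTransition.contDiff (n := 1)).continuous_deriv (by simp)

theorem hasDerivAt_smoothTransition (u : ℝ) :
    HasDerivAt Real.smoothTransition (deriv Real.smoothTransition u) u :=
  ((Real.smoothTransition.contDiff (n := 1)).differentiable (by simp)).differentiableAt.hasDerivAt

/-- With `u = (n+1)w - 1` this bounds `(n+1) w S'(u)` uniformly in `n`: the slope of the cutoff
times the distance `w` to the endpoint. -/
theorem exists_abs_deriv_smoothTransition_mul_le :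
    ∃ K, 0 ≤ K ∧ ∀ u, |deriv Real.smoothTransition u * (u + 1)| ≤ K := by
  obtain ⟨K, hK⟩ := (isCompact_Icc (a := (0 : ℝ)) (b := 1)).exists_bound_of_continuousOn
    (f := fun u => deriv Real.smoothTransition u * (u + 1))
    (continuous_deriv_smoothTransition.mul (by fun_prop)).continuousOn
  have hK0 : 0 ≤ K := (norm_nonneg _).trans (hK 0 (by simp))
  refine ⟨K, hK0, fun u => ?_⟩
  rcases lt_or_ge u 0 with h0 | h0
  · simpa [deriv_smoothTransition_of_neg h0] using hK0
  rcases lt_or_ge 1 u with h1 | h1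
  · simpa [deriv_smoothTransition_of_one_lt h1] using hK0
  exact hK u ⟨h0, h1⟩

/-- By the mean value inequality, a function vanishing at the endpoints is dominated by the distance
to them. This decay absorbs the growing slope of the cutoff. -/
theorem exists_abs_le_mul_of_contDiff {g : ℝ → ℝ} (hg : ContDiff ℝ ∞ g) (hab : a < b)
    (ha : g a = 0) (hb : g b = 0) :
    ∃ M, ∀ t ∈ Set.Icc a b, |g t| ≤ M * (t - a) ∧ |g t| ≤ M * (b - t) := by
  obtain ⟨M, hM⟩ := (isCompact_Icc (a := a) (b := b)).exists_bound_of_continuousOn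
    (hg.continuous_deriv (by simp)).continuousOn
  have h := fun x hx y hy => (convex_Icc a b).norm_image_sub_le_of_norm_deriv_le (f := g) (C := M)
    (x := x) (y := y) (fun x _ => (hg.differentiable (by simp)).differentiableAt) hM hx hy
  refine ⟨M, fun t ht => ⟨?_, ?_⟩⟩
  · have := h a ⟨le_rfl, hab.le⟩ t ht
    rwa [ha, sub_zero, Real.norm_eq_abs, Real.norm_eq_abs, abs_of_nonneg (a := t - a)
      (by linarith [ht.1])] at this
  · have := h b ⟨hab.le, le_rfl⟩ t ht
    rwa [hb, sub_zero, Real.norm_eq_abs, Real.norm_eq_abs, abs_sub_comm, abs_of_nonneg (a := b - t)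
      (by linarith [ht.2])] at this

/-- Approximation of a smooth function by test functions on `(a,b)`. -/
theorem exists_cutoff {g : ℝ → ℝ} (hg : ContDiff ℝ ∞ g) (hab : a < b) :
    ∃ θ θ' : ℕ → C(ℝ, ℝ), (∀ n, ContDiff ℝ ∞ (θ n)) ∧
      (∀ n, ∃ K ⊆ Set.Ioo a b, IsCompact K ∧ ∀ t ∉ K, θ n t = 0) ∧
      (∀ n t, HasDerivAt (θ n) (θ' n t) t) ∧
      (∀ t ∈ Set.Ioo a b, ∀ᶠ n in atTop, θ n t = g t ∧ θ' n t = deriv g t) ∧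
      (∃ C, ∀ n, ∀ t ∈ Set.Icc a b, |θ n t| ≤ C) ∧
      (g a = 0 → g b = 0 → ∃ C, ∀ n, ∀ t ∈ Set.Icc a b, |θ' n t| ≤ C) := by
  have hS : ContDiff ℝ ∞ Real.smoothTransition := Real.smoothTransition.contDiff
  have hSc := Real.smoothTransition.continuous
  have hS'c := continuous_deriv_smoothTransition
  have hgc := hg.continuous
  have hg'c : Continuous (deriv g) := hg.continuous_deriv (by simp)
  set S := Real.smoothTransition with hSdef
  -- The shift by `1` makes the cutoff vanish within `1/(n+1)` of the endpoint, which gives compact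
  -- support in the open interval; it equals one from distance `2/(n+1)` on.
  set u : ℕ → ℝ → ℝ := fun n t => (n + 1) * (t - a) - 1 with hu
  set v : ℕ → ℝ → ℝ := fun n t => (n + 1) * (b - t) - 1 with hv
  have huc : ∀ n, Continuous (u n) := fun n => by fun_prop
  have hvc : ∀ n, Continuous (v n) := fun n => by fun_prop
  have hud : ∀ n t, HasDerivAt (u n) (n + 1) t := fun n t => by
    exact ((((hasDerivAt_id t).sub_const a).const_mul ((n : ℝ) + 1)).sub_const 1).congr_deriv
      (by ring)
  have hvd : ∀ n t, HasDerivAt (v n) (-(n + 1)) t := fun n t => by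
    exact ((((hasDerivAt_id t).const_sub b).const_mul ((n : ℝ) + 1)).sub_const 1).congr_deriv
      (by ring)
  have hSle : ∀ x, |S x| ≤ 1 := fun x => by
    rw [abs_of_nonneg (Real.smoothTransition.nonneg x)]
    exact Real.smoothTransition.le_one x
  refine ⟨fun n => ⟨fun t => S (u n t) * S (v n t) * g t, by fun_prop⟩,
    fun n => ⟨fun t => (deriv S (u n t) * (n + 1) * S (v n t) +
      S (u n t) * (deriv S (v n t) * -(n + 1))) * g t + S (u n t) * S (v n t) * deriv g t,
      by fun_prop⟩, fun n => ?_, fun n => ?_, fun n t => ?_, fun t ht => ?_, ?_, ?_⟩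
  · have h1 : ContDiff ℝ ∞ (u n) := by fun_prop
    have h2 : ContDiff ℝ ∞ (v n) := by fun_prop
    exact ((hS.comp h1).mul (hS.comp h2)).mul hg
  · have hn : (0 : ℝ) < n + 1 := by positivity
    refine ⟨Set.Icc (a + 1 / (n + 1)) (b - 1 / (n + 1)), ?_, isCompact_Icc, fun t ht => ?_⟩
    · intro t ht
      have : (0 : ℝ) < 1 / (n + 1) := by positivity
      exact ⟨by linarith [ht.1], by linarith [ht.2]⟩
    · change S (u n t) * S (v n t) * g t = 0
      rw [Set.mem_Icc, not_and_or, not_le, not_le] at ht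
      rcases ht with ht | ht
      · have : u n t ≤ 0 := by
          have : (t - a) < 1 / (n + 1) := by linarith
          rw [lt_div_iff₀ hn] at this
          simp only [hu]; linarith
        rw [hSdef, Real.smoothTransition.zero_of_nonpos this, zero_mul, zero_mul]
      · have : v n t ≤ 0 := by
          have : (b - t) < 1 / (n + 1) := by linarith
          rw [lt_div_iff₀ hn] at this
          simp only [hv]; linarith
        rw [hSdef, Real.smoothTransition.zero_of_nonpos this, mul_zero, zero_mul]
  · exact (((hasDerivAt_smoothTransition (u n t)).comp t (hud n t)).mul
      ((hasDerivAt_smoothTransition (v n t)).comp t (hvd n t))).mul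
      (hg.differentiable (by simp)).differentiableAt.hasDerivAt
  · have htend : Tendsto (fun n : ℕ => (n : ℝ) + 1) atTop atTop :=
      tendsto_atTop_add_const_right _ _ tendsto_natCast_atTop_atTop
    filter_upwards [(htend.atTop_mul_const (sub_pos.2 ht.1)).eventually_gt_atTop 2,
      (htend.atTop_mul_const (sub_pos.2 ht.2)).eventually_gt_atTop 2] with n h1 h2
    have hu1 : 1 < u n t := by simp only [hu]; linarith
    have hv1 : 1 < v n t := by simp only [hv]; linarith
    constructor
    · change S (u n t) * S (v n t) * g t = g t
      rw [hSdef, Real.smoothTransition.one_of_one_le hu1.le,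
        Real.smoothTransition.one_of_one_le hv1.le, one_mul, one_mul]
    · change (deriv S (u n t) * (n + 1) * S (v n t) +
        S (u n t) * (deriv S (v n t) * -(n + 1))) * g t + S (u n t) * S (v n t) * deriv g t = _
      rw [hSdef, deriv_smoothTransition_of_one_lt hu1, deriv_smoothTransition_of_one_lt hv1,
        Real.smoothTransition.one_of_one_le hu1.le, Real.smoothTransition.one_of_one_le hv1.le]
      ring
  · obtain ⟨C, hC⟩ := (isCompact_Icc (a := a) (b := b)).exists_bound_of_continuousOn
      hgc.continuousOn
    refine ⟨C, fun n t ht => ?_⟩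
    change |S (u n t) * S (v n t) * g t| ≤ C
    rw [abs_mul, abs_mul]
    calc |S (u n t)| * |S (v n t)| * |g t| ≤ 1 * 1 * |g t| := by
          gcongr <;> exact hSle _
      _ ≤ C := by simpa using hC t ht
  · intro ha hb
    obtain ⟨C, hC⟩ := (isCompact_Icc (a := a) (b := b)).exists_bound_of_continuousOn
      hg'c.continuousOn
    obtain ⟨M, hM⟩ := exists_abs_le_mul_of_contDiff hg hab ha hb
    obtain ⟨K, hK0, hK⟩ := exists_abs_deriv_smoothTransition_mul_le
    have hM0 : 0 ≤ M := by
      have := (abs_nonneg _).trans (hM b ⟨hab.le, le_rfl⟩).1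
      exact nonneg_of_mul_nonneg_left this (sub_pos.2 hab)
    have hpart : ∀ (n : ℕ) (w s : ℝ), |g s| ≤ M * w → 0 ≤ w →
        |deriv S ((n + 1) * w - 1)| * (n + 1) * |g s| ≤ K * M := fun n w s h hw => by
      calc |deriv S ((n + 1) * w - 1)| * (n + 1) * |g s|
          ≤ |deriv S ((n + 1) * w - 1)| * (n + 1) * (M * w) := by gcongr
        _ = |deriv S ((n + 1) * w - 1) * (((n + 1) * w - 1) + 1)| * M := by
          rw [abs_mul, sub_add_cancel, abs_of_nonneg (a := ((n : ℝ) + 1) * w) (by positivity)]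
          ring
        _ ≤ K * M := by gcongr; exact hK _
    refine ⟨K * M + K * M + C, fun n t ht => ?_⟩
    change |(deriv S (u n t) * (n + 1) * S (v n t) +
        S (u n t) * (deriv S (v n t) * -(n + 1))) * g t + S (u n t) * S (v n t) * deriv g t| ≤ _
    have hn : (0 : ℝ) ≤ n + 1 := by positivity
    have e1 : |deriv S (u n t) * (n + 1) * S (v n t) * g t| ≤ K * M := by
      rw [abs_mul, abs_mul, abs_mul, abs_of_nonneg hn]
      calc _ ≤ |deriv S (u n t)| * (n + 1) * 1 * |g t| := by gcongr; exact hSle _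
        _ ≤ K * M := by
          rw [mul_one]
          exact hpart n (t - a) t (hM t ht).1 (by linarith [ht.1])
    have e2 : |S (u n t) * (deriv S (v n t) * -(n + 1)) * g t| ≤ K * M := by
      rw [abs_mul, abs_mul, abs_mul, abs_neg, abs_of_nonneg hn]
      calc _ ≤ 1 * (|deriv S (v n t)| * (n + 1)) * |g t| := by gcongr; exact hSle _
        _ ≤ K * M := by
          rw [one_mul]
          exact hpart n (b - t) t (hM t ht).2 (by linarith [ht.2])
    have e3 : |S (u n t) * S (v n t) * deriv g t| ≤ C := by
      rw [abs_mul, abs_mul]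
      calc |S (u n t)| * |S (v n t)| * |deriv g t| ≤ 1 * 1 * |deriv g t| := by
            gcongr <;> exact hSle _
        _ ≤ C := by simpa using hC t ht
    rw [add_mul]
    exact (abs_add_three _ _ _).trans (by linarith)

theorem ae_mem_openCube (a b : ℝ) (d : ℕ) : ∀ᵐ x ∂(cubeMeasure a b d), x ∈ openCube a b d := by
  have h : cubeMeasure a b d = volume.restrict (openCube a b d) := by
    rw [cubeMeasure_eq_pi, openCube, volume_pi, Measure.restrict_pi_pi]
    congr 1
    funext i
    exact Measure.restrict_congr_set Ioo_ae_eq_Icc.symm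
  rw [h]
  exact ae_restrict_mem (MeasurableSet.univ_pi fun _ => measurableSet_Ioo)

theorem ae_mem_cube (a b : ℝ) (d : ℕ) :
    ∀ᵐ x ∂(cubeMeasure a b d), ∀ i, x i ∈ Set.Icc a b := by
  filter_upwards [ae_mem_openCube a b d] with x hx i
  exact Set.Ioo_subset_Icc_self (hx i (Set.mem_univ i))

/-- Dominated convergence: the faces of the cube are null, inside it the factors are eventually
equal to their limits, and `f` is integrable on the cube. -/
theorem tendsto_integral_tensorProd_smul {𝕜 : Type*} [RCLike 𝕜] (f : L2Cube 𝕜 a b d)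
    {Θ : ℕ → Fin d → C(ℝ, ℝ)} {g : Fin d → C(ℝ, ℝ)}
    (hΘ : ∀ i, ∀ t ∈ Set.Ioo a b, ∀ᶠ n in atTop, Θ n i t = g i t)
    (hb : ∀ i, ∃ C, ∀ n, ∀ t ∈ Set.Icc a b, |Θ n i t| ≤ C) :
    Tendsto (fun n => ∫ x, tensorProd (Θ n) x • f x ∂(cubeMeasure a b d)) atTop
      (𝓝 (∫ x, tensorProd g x • f x ∂(cubeMeasure a b d))) := by
  choose C hC using hb
  have hf : Integrable f (cubeMeasure a b d) := (Lp.memLp f).integrable (by norm_num)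
  refine tendsto_integral_of_dominated_convergence (fun x => (∏ i, C i) * ‖f x‖)
    (fun n => (continuous_tensorProd _).aestronglyMeasurable.smul hf.aestronglyMeasurable)
    (hf.norm.const_mul _) (fun n => ?_) ?_
  · filter_upwards [ae_mem_cube a b d] with x hx
    rw [norm_smul]
    gcongr
    rw [tensorProd, Real.norm_eq_abs, Finset.abs_prod]
    exact Finset.prod_le_prod (fun _ _ => abs_nonneg _) fun i _ => hC i n _ (hx i)
  · filter_upwards [ae_mem_openCube a b d] with x hx
    refine tendsto_const_nhds.congr' ?_
    filter_upwards [eventually_all.2 fun i => hΘ i (x i) (hx i (Set.mem_univ i))] with n hn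
    rw [tensorProd, tensorProd, Finset.prod_congr rfl fun i _ => (hn i).symm]

theorem isTestFunction_tensorProd {θ : Fin d → C(ℝ, ℝ)} (h : ∀ i, ContDiff ℝ ∞ (θ i))
    (hK : ∀ i, ∃ K ⊆ Set.Ioo a b, IsCompact K ∧ ∀ t ∉ K, θ i t = 0) :
    IsTestFunction a b d (tensorProd θ) := by
  choose K hKs hKc hK0 using hK
  have hs : Function.support (tensorProd θ) ⊆ Set.univ.pi K := fun x hx i _ => by
    by_contra hi
    exact hx (Finset.prod_eq_zero (Finset.mem_univ i) (hK0 i _ hi))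
  have hc : IsCompact (Set.univ.pi K) := isCompact_univ_pi hKc
  have hts : tsupport (tensorProd θ) ⊆ Set.univ.pi K := closure_minimal hs hc.isClosed
  exact ⟨contDiff_prod fun i _ => (h i).comp (contDiff_apply ℝ ℝ i),
    HasCompactSupport.of_support_subset_isCompact hc hs,
    hts.trans (Set.pi_mono fun i _ => hKs i)⟩

/-- Integration by parts against tensor products vanishing on two opposite faces of the cube. -/
theorem HasWeakPartialDeriv.inner_tensorL2 {𝕜 : Type*} [RCLike 𝕜] (hab : a < b) {i : Fin d}
    {f h : L2Cube 𝕜 a b d} (hfh : HasWeakPartialDeriv i f h) {g : Fin d → C(ℝ, ℝ)} {g' : C(ℝ, ℝ)}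
    (hg : ∀ j, ContDiff ℝ ∞ (g j)) (hg' : ∀ t, deriv (g i) t = g' t) (ha : g i a = 0)
    (hb : g i b = 0) :
    inner 𝕜 (tensorL2 𝕜 a b g) h = -inner 𝕜 (tensorL2 𝕜 a b (Function.update g i g')) f := by
  -- All coordinates are cut off, but only the `i`-th cutoff is differentiated. Hence vanishing at
  -- the endpoints is needed for `g i` alone.
  choose θ θ' h1 h2 h3 h4 h5 h6 using fun j => exists_cutoff (hg j) hab
  have ht : ∀ n, IsTestFunction a b d (tensorProd fun j => θ j n) := fun n =>
    isTestFunction_tensorProd (fun j => h1 j n) fun j => h2 j n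
  have hp : ∀ n, partialDeriv i (tensorProd fun j => θ j n) =
      tensorProd (Function.update (fun j => θ j n) i (θ' i n)) := fun n => by
    funext x
    have e1 := ((((ht n).contDiff.differentiable
      (by simp)).differentiableAt (x := x)).hasFDerivAt.hasLineDerivAt (Pi.single i 1))
    exact e1.unique (hasLineDerivAt_tensorProd (h3 i n _))
  have hw : ∀ n, ∫ x, tensorProd (fun j => θ j n) x • h x ∂(cubeMeasure a b d) =
      -∫ x, tensorProd (Function.update (fun j => θ j n) i (θ' i n)) x • f x
        ∂(cubeMeasure a b d) := fun n => by
    rw [hfh _ (ht n), hp]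
  rw [MixedSobolev.inner_tensorL2, MixedSobolev.inner_tensorL2]
  refine tendsto_nhds_unique (tendsto_integral_tensorProd_smul h (Θ := fun n j => θ j n)
    (fun j t htt => (h4 j t htt).mono fun n hn => hn.1) h5) ?_
  simp only [hw]
  refine (tendsto_integral_tensorProd_smul f fun j t htt => ?_) (fun j => ?_) |>.neg
  · rcases eq_or_ne j i with rfl | hj
    · filter_upwards [h4 j t htt] with n hn
      rw [Function.update_self, Function.update_self, hn.2, hg']
    · filter_upwards [h4 j t htt] with n hn
      rw [Function.update_of_ne hj, Function.update_of_ne hj, hn.1]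
  · rcases eq_or_ne j i with rfl | hj
    · simpa only [Function.update_self] using h6 j ha hb
    · simpa only [Function.update_of_ne hj] using h5 j

end Cutoff

/-! ### The cosine basis: orthonormality and completeness -/

section Cosine

variable {a b : ℝ} {d : ℕ}

/-- The orthonormal cosine basis of `L²([a,a+1])`. -/
noncomputable def cosFun (a : ℝ) (k : ℕ) : C(ℝ, ℝ) :=
  ⟨fun t => (if k = 0 then 1 else √2) * Real.cos (k * Real.pi * (t - a)), by fun_prop⟩

/-- The orthonormal sine system in `L²([a,a+1])`; it vanishes for `k = 0`. -/
noncomputable def sinFun (a : ℝ) (k : ℕ) : C(ℝ, ℝ) :=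
  ⟨fun t => √2 * Real.sin (k * Real.pi * (t - a)), by fun_prop⟩

theorem contDiff_cosFun (a : ℝ) (k : ℕ) : ContDiff ℝ ∞ (cosFun a k) :=
  contDiff_const.mul (Real.contDiff_cos.comp (by fun_prop))

theorem contDiff_sinFun (a : ℝ) (k : ℕ) : ContDiff ℝ ∞ (sinFun a k) :=
  contDiff_const.mul (Real.contDiff_sin.comp (by fun_prop))

theorem deriv_sinFun (a : ℝ) (k : ℕ) (t : ℝ) :
    deriv (sinFun a k) t = ((k * Real.pi) • cosFun a k) t := by
  have h1 : HasDerivAt (fun t : ℝ => (k : ℝ) * Real.pi * (t - a)) (k * Real.pi) t := by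
    simpa using! ((hasDerivAt_id t).sub_const a).const_mul ((k : ℝ) * Real.pi)
  have h2 : HasDerivAt (sinFun a k) (√2 * (Real.cos (k * Real.pi * (t - a)) * (k * Real.pi))) t :=
    h1.sin.const_mul √2
  rw [h2.deriv]
  change _ = k * Real.pi * ((if k = 0 then 1 else √2) * Real.cos (k * Real.pi * (t - a)))
  split_ifs with h
  · simp [h]
  · ring

theorem sinFun_left (a : ℝ) (k : ℕ) : sinFun a k a = 0 := by
  simp [sinFun]

theorem sinFun_right (hab : b - a = 1) (k : ℕ) : sinFun a k b = 0 := by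
  simp [sinFun, hab, Real.sin_nat_mul_pi]

theorem setIntegral_Icc_sub_left (hab : b - a = 1) (F : ℝ → ℝ) :
    ∫ t in Set.Icc a b, F (t - a) = ∫ t in (0 : ℝ)..1, F t := by
  rw [integral_Icc_eq_integral_Ioc, ← intervalIntegral.integral_of_le (by linarith),
    intervalIntegral.integral_comp_sub_right, sub_self, hab]

theorem integral_cos_int_mul_pi (m : ℤ) :
    ∫ t in (0 : ℝ)..1, Real.cos (m * Real.pi * t) = if m = 0 then 1 else 0 := by
  split_ifs with h
  · simp [h]
  · have hm : (m : ℝ) * Real.pi ≠ 0 := mul_ne_zero (by exact_mod_cast h) Real.pi_ne_zero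
    rw [intervalIntegral.integral_comp_mul_left _ hm, integral_cos]
    simp [Real.sin_int_mul_pi]

theorem intervalIntegrable_cos_int_mul_pi (m : ℤ) :
    IntervalIntegrable (fun t => Real.cos (m * Real.pi * t)) volume 0 1 :=
  Continuous.intervalIntegrable (by fun_prop) _ _

theorem integral_cosFun_mul (hab : b - a = 1) (j k : ℕ) :
    ∫ t in Set.Icc a b, cosFun a j t * cosFun a k t = if j = k then 1 else 0 := by
  set cj : ℝ := if j = 0 then 1 else √2 with hj
  set ck : ℝ := if k = 0 then 1 else √2 with hk
  have h1 : ∀ s : ℝ, cj * Real.cos (j * Real.pi * s) * (ck * Real.cos (k * Real.pi * s)) =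
      cj * ck / 2 * (Real.cos (((j : ℤ) - k : ℤ) * Real.pi * s) +
        Real.cos (((j : ℤ) + k : ℤ) * Real.pi * s)) := fun s => by
    have e1 : (((j : ℤ) - k : ℤ) : ℝ) * Real.pi * s = j * Real.pi * s - k * Real.pi * s := by
      push_cast; ring
    have e2 : (((j : ℤ) + k : ℤ) : ℝ) * Real.pi * s = j * Real.pi * s + k * Real.pi * s := by
      push_cast; ring
    rw [e1, e2, Real.cos_sub, Real.cos_add]
    ring
  refine (setIntegral_Icc_sub_left hab fun s =>
    cj * Real.cos (j * Real.pi * s) * (ck * Real.cos (k * Real.pi * s))).trans ?_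
  simp only [h1]
  rw [intervalIntegral.integral_const_mul, intervalIntegral.integral_add
    (intervalIntegrable_cos_int_mul_pi _) (intervalIntegrable_cos_int_mul_pi _),
    integral_cos_int_mul_pi, integral_cos_int_mul_pi]
  rcases eq_or_ne j k with rfl | hne
  · rcases eq_or_ne j 0 with rfl | h0
    · norm_num [hj, hk]
    · have : ¬ ((j : ℤ) + j = 0) := by omega
      simp [hj, hk, h0, this]
  · have e1 : ¬ ((j : ℤ) - k = 0) := by omega
    have e2 : ¬ ((j : ℤ) + k = 0) := by omega
    simp [hne, e1, e2]

theorem integral_sinFun_mul (hab : b - a = 1) {j k : ℕ} (hj : j ≠ 0) :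
    ∫ t in Set.Icc a b, sinFun a j t * sinFun a k t = if j = k then 1 else 0 := by
  have h1 : ∀ s : ℝ, √2 * Real.sin (j * Real.pi * s) * (√2 * Real.sin (k * Real.pi * s)) =
      Real.cos (((j : ℤ) - k : ℤ) * Real.pi * s) -
        Real.cos (((j : ℤ) + k : ℤ) * Real.pi * s) := fun s => by
    have e1 : (((j : ℤ) - k : ℤ) : ℝ) * Real.pi * s = j * Real.pi * s - k * Real.pi * s := by
      push_cast; ring
    have e2 : (((j : ℤ) + k : ℤ) : ℝ) * Real.pi * s = j * Real.pi * s + k * Real.pi * s := by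
      push_cast; ring
    rw [e1, e2, Real.cos_sub, Real.cos_add]
    linear_combination Real.sin (j * Real.pi * s) * Real.sin (k * Real.pi * s) *
      Real.sq_sqrt (show (0 : ℝ) ≤ 2 by norm_num)
  refine (setIntegral_Icc_sub_left hab fun s =>
    √2 * Real.sin (j * Real.pi * s) * (√2 * Real.sin (k * Real.pi * s))).trans ?_
  simp only [h1]
  rw [intervalIntegral.integral_sub
    (intervalIntegrable_cos_int_mul_pi _) (intervalIntegrable_cos_int_mul_pi _),
    integral_cos_int_mul_pi, integral_cos_int_mul_pi]
  have e2 : ¬ ((j : ℤ) + k = 0) := by omega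
  rcases eq_or_ne j k with rfl | hne
  · simp [e2]
  · have e1 : ¬ ((j : ℤ) - k = 0) := by omega
    simp [hne, e1, e2]

/-- The factors of the basis function with index `k`, differentiated in the directions `α`, up to
constants. -/
noncomputable def trigFactors (a : ℝ) (α : Finset (Fin d)) (k : Fin d → ℕ) (i : Fin d) : C(ℝ, ℝ) :=
  if i ∈ α then sinFun a (k i) else cosFun a (k i)

/-- Frequencies that are zero in a direction of `α` are excluded because the corresponding sine is
zero. -/
theorem orthonormal_trig (𝕜 : Type*) [RCLike 𝕜] (hab : b - a = 1) (α : Finset (Fin d)) :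
    Orthonormal 𝕜 fun k : {k : Fin d → ℕ // ∀ i ∈ α, k i ≠ 0} =>
      tensorL2 𝕜 a b (trigFactors a α k.1) := by
  rw [orthonormal_iff_ite]
  intro j k
  have h : ∀ i, ∫ t in Set.Icc a b, trigFactors a α j.1 i t * trigFactors a α k.1 i t =
      if j.1 i = k.1 i then 1 else 0 := fun i => by
    by_cases hi : i ∈ α
    · simp only [trigFactors, hi, if_true]
      exact integral_sinFun_mul hab (j.2 i hi)
    · simp only [trigFactors, hi, if_false]
      exact integral_cosFun_mul hab _ _
  rw [inner_tensorL2_tensorL2, Finset.prod_congr rfl fun i _ => h i]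
  split_ifs with hjk
  · simp [hjk]
  · obtain ⟨i, hi⟩ : ∃ i, j.1 i ≠ k.1 i := by
      by_contra! h'
      exact hjk (Subtype.ext (funext h'))
    rw [Finset.prod_eq_zero (Finset.mem_univ i) (if_neg hi), RCLike.ofReal_zero]

/-- The tensor product cosine basis of `L²([a,b]^d)`. -/
noncomputable def cosL2 (𝕜 : Type*) [RCLike 𝕜] (a b : ℝ) (k : Fin d → ℕ) : L2Cube 𝕜 a b d :=
  tensorL2 𝕜 a b fun i => cosFun a (k i)

theorem trigFactors_empty (a : ℝ) (k : Fin d → ℕ) :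
    trigFactors a ∅ k = fun i => cosFun a (k i) := by
  funext i
  simp [trigFactors]

theorem orthonormal_cosL2 (𝕜 : Type*) [RCLike 𝕜] (hab : b - a = 1) :
    Orthonormal 𝕜 (cosL2 𝕜 a b : (Fin d → ℕ) → L2Cube 𝕜 a b d) := by
  have h := (orthonormal_trig 𝕜 (d := d) hab ∅).comp (fun k => ⟨k, by simp⟩)
    fun j k hjk => congrArg Subtype.val hjk
  simpa only [Function.comp_def, trigFactors_empty] using! h

/-- The product of the functions `x_i ↦ cos(m_i π (x_i - a))`. -/
noncomputable def cosProd (a : ℝ) (m : Fin d → ℤ) : C(Fin d → ℝ, ℝ) :=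
  ⟨fun x => ∏ i, Real.cos (m i * Real.pi * (x i - a)), by fun_prop⟩

/-- The change of variables `x_i ↦ cos(π (x_i - a))`. -/
noncomputable def cosMap (a : ℝ) (d : ℕ) : C(Fin d → ℝ, Fin d → ℝ) :=
  ⟨fun x i => Real.cos (Real.pi * (x i - a)), by fun_prop⟩

theorem cos_mul_cosProd (i : Fin d) (m : Fin d → ℤ) (x : Fin d → ℝ) :
    Real.cos (Real.pi * (x i - a)) * cosProd a m x =
      (1 / 2) * cosProd a (Function.update m i (m i + 1)) x +
        (1 / 2) * cosProd a (Function.update m i (m i - 1)) x := by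
  have h : ∀ n : ℤ, cosProd a (Function.update m i n) x = Real.cos (n * Real.pi * (x i - a)) *
      ∏ j ∈ Finset.univ.erase i, Real.cos (m j * Real.pi * (x j - a)) := fun n => by
    change ∏ j : Fin d, _ = _
    rw [← Finset.mul_prod_erase _ _ (Finset.mem_univ i), Function.update_self]
    congr 1
    exact Finset.prod_congr rfl fun j hj => by
      rw [Function.update_of_ne (Finset.ne_of_mem_erase hj)]
  have h0 := h (m i)
  rw [Function.update_eq_self] at h0
  rw [h0, h, h]
  have e1 : ((m i + 1 : ℤ) : ℝ) * Real.pi * (x i - a) =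
      m i * Real.pi * (x i - a) + Real.pi * (x i - a) := by push_cast; ring
  have e2 : ((m i - 1 : ℤ) : ℝ) * Real.pi * (x i - a) =
      m i * Real.pi * (x i - a) - Real.pi * (x i - a) := by push_cast; ring
  rw [e1, e2, Real.cos_add, Real.cos_sub]
  ring

/-- Multiplication by one coordinate of `cosMap` shifts a frequency by `±1`, by the product-to-sum
formula. Integer frequencies avoid a case distinction at zero. -/
theorem comp_cosMap_mem_span {P : C(Fin d → ℝ, ℝ)}
    (hP : P ∈ Algebra.adjoin ℝ (Set.range fun i : Fin d =>
      (⟨fun y => y i, continuous_apply i⟩ : C(Fin d → ℝ, ℝ)))) :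
    P.comp (cosMap a d) ∈ Submodule.span ℝ (Set.range (cosProd a : (Fin d → ℤ) → _)) := by
  set W := Submodule.span ℝ (Set.range (cosProd a : (Fin d → ℤ) → C(Fin d → ℝ, ℝ))) with hW
  -- Invariance of the span under multiplication is the claim that survives products of polynomials;
  -- it is finally applied to `w = 1`.
  have key : ∀ w ∈ W, P.comp (cosMap a d) * w ∈ W := by
    induction hP using Algebra.adjoin_induction with
    | mem P hP =>
      obtain ⟨i, rfl⟩ := hP
      intro w hw
      induction hw using Submodule.span_induction with
      | mem w hw =>
        obtain ⟨m, rfl⟩ := hw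
        have : (⟨fun y => y i, continuous_apply i⟩ : C(Fin d → ℝ, ℝ)).comp (cosMap a d) *
            cosProd a m = (1 / 2 : ℝ) • cosProd a (Function.update m i (m i + 1)) +
              (1 / 2 : ℝ) • cosProd a (Function.update m i (m i - 1)) :=
          ContinuousMap.ext fun x => cos_mul_cosProd i m x
        rw [this]
        exact W.add_mem (W.smul_mem _ (Submodule.subset_span ⟨_, rfl⟩))
          (W.smul_mem _ (Submodule.subset_span ⟨_, rfl⟩))
      | zero => rw [mul_zero]; exact W.zero_mem
      | add u v _ _ hu hv => rw [mul_add]; exact W.add_mem hu hv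
      | smul c u _ hu => rw [mul_smul_comm]; exact W.smul_mem c hu
    | algebraMap c =>
      intro w hw
      have : (algebraMap ℝ C(Fin d → ℝ, ℝ) c).comp (cosMap a d) * w = c • w :=
        ContinuousMap.ext fun x => rfl
      rw [this]
      exact W.smul_mem c hw
    | add P Q _ _ hP hQ =>
      intro w hw
      have : (P + Q).comp (cosMap a d) * w = P.comp (cosMap a d) * w + Q.comp (cosMap a d) * w :=
        ContinuousMap.ext fun x => add_mul _ _ _
      rw [this]
      exact W.add_mem (hP w hw) (hQ w hw)
    | mul P Q _ _ hP hQ =>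
      intro w hw
      have : (P * Q).comp (cosMap a d) * w = P.comp (cosMap a d) * (Q.comp (cosMap a d) * w) :=
        ContinuousMap.ext fun x => mul_assoc _ _ _
      rw [this]
      exact hP _ (hQ w hw)
  have h1 : (1 : C(Fin d → ℝ, ℝ)) ∈ W := by
    refine Submodule.subset_span ⟨0, ContinuousMap.ext fun x => ?_⟩
    simp [cosProd]
  simpa using key 1 h1

/-- Trigonometric polynomials are dense in the continuous functions on the cube. -/
theorem exists_mem_span_cosProd_near (hab : b - a = 1) (φ : C(Fin d → ℝ, ℝ)) {ε : ℝ}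
    (hε : 0 < ε) : ∃ w ∈ Submodule.span ℝ (Set.range (cosProd a : (Fin d → ℤ) → _)),
      ∀ x : Fin d → ℝ, (∀ i, x i ∈ Set.Icc a b) → |w x - φ x| < ε := by
  set A := Algebra.adjoin ℝ (Set.range fun i : Fin d =>
      (⟨fun y => y i, continuous_apply i⟩ : C(Fin d → ℝ, ℝ))) with hA
  have hsep : A.SeparatesPoints := fun x y hxy => by
    obtain ⟨i, hi⟩ := Function.ne_iff.1 hxy
    exact ⟨_, ⟨_, Algebra.subset_adjoin ⟨i, rfl⟩, rfl⟩, hi⟩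
  -- This is the inverse of `cosMap` on the cube, and `Real.arccos` is continuous on all of `ℝ`.
  -- Stone–Weierstrass then applies to `φ` in the variables `y` on `[-1,1]^d`.
  have hinv : Continuous fun y : Fin d → ℝ => fun i => a + Real.arccos (y i) / Real.pi :=
    continuous_pi fun i => (continuous_const.add
      ((Real.continuous_arccos.comp (continuous_apply i)).div_const _))
  obtain ⟨P, hP, hPφ⟩ :=
    ContinuousMap.exists_mem_subalgebra_near_continuous_of_isCompact_of_separatesPoints hsep
    (φ.comp ⟨_, hinv⟩) (isCompact_univ_pi fun _ : Fin d => isCompact_Icc (a := (-1 : ℝ)) (b := 1))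
    hε
  refine ⟨P.comp (cosMap a d), comp_cosMap_mem_span hP, fun x hx => ?_⟩
  have h := hPφ (cosMap a d x) fun i _ => ⟨Real.neg_one_le_cos _, Real.cos_le_one _⟩
  have hxe : (fun i => a + Real.arccos (cosMap a d x i) / Real.pi) = x := funext fun i => by
    have h0 : 0 ≤ x i - a := by linarith [(hx i).1]
    have h1 : x i - a ≤ 1 := by linarith [(hx i).2]
    change a + Real.arccos (Real.cos (Real.pi * (x i - a))) / Real.pi = x i
    rw [Real.arccos_cos (by positivity) (by nlinarith [Real.pi_pos]),
      mul_div_cancel_left₀ _ Real.pi_ne_zero]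
    ring
  change ‖P (cosMap a d x) - φ (fun i => a + Real.arccos (cosMap a d x i) / Real.pi)‖ < ε at h
  rwa [hxe] at h

theorem integrable_continuous_smul {𝕜 : Type*} [RCLike 𝕜] (f : L2Cube 𝕜 a b d)
    (φ : C(Fin d → ℝ, ℝ)) : Integrable (fun x => φ x • f x) (cubeMeasure a b d) := by
  have hf : Integrable f (cubeMeasure a b d) := (Lp.memLp f).integrable (by norm_num)
  obtain ⟨C, hC⟩ :=
    (isCompact_univ_pi fun _ : Fin d => isCompact_Icc (a := a) (b := b)).exists_bound_of_continuousOn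
    φ.continuous.continuousOn
  refine hf.bdd_smul C φ.continuous.aestronglyMeasurable ?_
  filter_upwards [ae_mem_cube a b d] with x hx using hC x fun i _ => hx i

/-- Orthogonality passes from the cosines to their span, by uniform approximation to all continuous
functions, and so in particular to smooth compactly supported ones, which determine `f` almost
everywhere. -/
theorem cosL2_complete {𝕜 : Type*} [RCLike 𝕜] (hab : b - a = 1) {f : L2Cube 𝕜 a b d}
    (hf : ∀ k, inner 𝕜 (cosL2 𝕜 a b k) f = 0) : f = 0 := by
  have h1 : ∀ m : Fin d → ℤ, ∫ x, cosProd a m x • f x ∂(cubeMeasure a b d) = 0 := fun m => by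
    have h := hf fun i => (m i).natAbs
    rw [cosL2, inner_tensorL2] at h
    have e : ∀ x, tensorProd (fun i => cosFun a (m i).natAbs) x =
        (∏ i, if (m i).natAbs = 0 then 1 else √2) * cosProd a m x := fun x => by
      change ∏ i : Fin d, _ = _ * ∏ i : Fin d, _
      rw [← Finset.prod_mul_distrib]
      refine Finset.prod_congr rfl fun i _ => ?_
      change _ * Real.cos _ = _
      congr 1
      rcases Int.natAbs_eq (m i) with h | h
      · conv_rhs => rw [h]
        rw [Int.cast_natCast]
      · conv_rhs => rw [h]
        rw [Int.cast_neg, Int.cast_natCast, neg_mul, neg_mul, Real.cos_neg]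
    simp only [e, mul_smul] at h
    rw [integral_smul] at h
    refine (smul_eq_zero.1 h).resolve_left (Finset.prod_ne_zero_iff.2 fun i _ => ?_)
    split_ifs
    · exact one_ne_zero
    · exact (Real.sqrt_pos.2 two_pos).ne'
  have h2 : ∀ w ∈ Submodule.span ℝ (Set.range (cosProd a : (Fin d → ℤ) → C(Fin d → ℝ, ℝ))),
      ∫ x, w x • f x ∂(cubeMeasure a b d) = 0 := fun w hw => by
    induction hw using Submodule.span_induction with
    | mem w hw =>
      obtain ⟨m, rfl⟩ := hw
      exact h1 m
    | zero => simp
    | add u v _ _ hu hv =>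
      simp only [ContinuousMap.add_apply, add_smul]
      rw [integral_add (integrable_continuous_smul f u) (integrable_continuous_smul f v), hu, hv,
        add_zero]
    | smul c u _ hu =>
      simp only [ContinuousMap.smul_apply, smul_assoc]
      rw [integral_smul, hu, smul_zero]
  have hfi : Integrable f (cubeMeasure a b d) := (Lp.memLp f).integrable (by norm_num)
  have h3 : ∀ φ : C(Fin d → ℝ, ℝ), ∫ x, φ x • f x ∂(cubeMeasure a b d) = 0 := fun φ => by
    rw [← norm_le_zero_iff]
    refine le_of_forall_pos_le_add fun δ hδ => ?_
    set I := ∫ x, ‖f x‖ ∂(cubeMeasure a b d) with hI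
    have hI0 : 0 ≤ I := integral_nonneg fun x => norm_nonneg _
    obtain ⟨w, hw, hwφ⟩ := exists_mem_span_cosProd_near hab φ (ε := δ / (I + 1)) (by positivity)
    have e : ∫ x, φ x • f x ∂(cubeMeasure a b d) =
        ∫ x, (φ x - w x) • f x ∂(cubeMeasure a b d) := by
      simp only [sub_smul]
      rw [integral_sub (integrable_continuous_smul f φ) (integrable_continuous_smul f w), h2 w hw,
        sub_zero]
    rw [e, zero_add]
    calc ‖∫ x, (φ x - w x) • f x ∂(cubeMeasure a b d)‖
        ≤ ∫ x, δ / (I + 1) * ‖f x‖ ∂(cubeMeasure a b d) := by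
          refine norm_integral_le_of_norm_le (hfi.norm.const_mul _) ?_
          filter_upwards [ae_mem_cube a b d] with x hx
          rw [norm_smul, Real.norm_eq_abs, abs_sub_comm]
          gcongr
          exact (hwφ x hx).le
      _ = δ / (I + 1) * I := by rw [integral_const_mul]
      _ ≤ δ := by
          rw [div_mul_eq_mul_div, div_le_iff₀ (by positivity)]
          nlinarith
  rw [Lp.eq_zero_iff_ae_eq_zero]
  exact ae_eq_zero_of_integral_contDiff_smul_eq_zero hfi.locallyIntegrable
    fun g hg _ => h3 ⟨g, hg.continuous⟩

end Cosine

/-! ### Weighted Bessel inequality and the cosine projection -/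

section Projection

variable {𝕜 : Type*} [RCLike 𝕜] {a b : ℝ} {d : ℕ} {r : ℕ∞}

/-- The indicator function of a set of directions as a multi-index. -/
def indicatorIndex (hr : 1 ≤ r) (α : Finset (Fin d)) : MultiIndex d r :=
  ⟨fun i => if i ∈ α then 1 else 0, fun i => by
    dsimp only
    split_ifs
    · exact_mod_cast hr
    · simp⟩

theorem indicatorIndex_empty (hr : 1 ≤ r) :
    indicatorIndex hr (∅ : Finset (Fin d)) = MultiIndex.zero d r :=
  Subtype.ext (funext fun i => by simp [indicatorIndex, MultiIndex.zero])

theorem indicatorIndex_insert (hr : 1 ≤ r) {α : Finset (Fin d)} {i : Fin d} (hi : i ∉ α) :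
    (indicatorIndex hr (insert i α)).1 = (indicatorIndex hr α).1 + Pi.single i 1 := by
  funext j
  rcases eq_or_ne j i with rfl | hj
  · simp [indicatorIndex, hi]
  · simp [indicatorIndex, hj]

theorem indicatorIndex_injective (hr : 1 ≤ r) :
    Function.Injective (indicatorIndex hr : Finset (Fin d) → MultiIndex d r) := fun α β h => by
  ext i
  have h1 := congrFun (congrArg Subtype.val h) i
  simp only [indicatorIndex] at h1
  by_cases h2 : i ∈ α <;> by_cases h3 : i ∈ β <;> simp_all

/-- One integration by parts for each direction in `α`, each producing a factor `-k_i π` and turning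
a sine into a cosine. Adding directions one at a time matches the membership condition of
`weakSobolev`, which links neighbouring multi-indices only. -/
theorem inner_trigFactors (hab : b - a = 1) (hr : 1 ≤ r) (u : weakSobolev 𝕜 a b d r)
    (k : Fin d → ℕ) (α : Finset (Fin d)) :
    inner 𝕜 (tensorL2 𝕜 a b (trigFactors a α k)) (u.1 (indicatorIndex hr α)) =
      (∏ i ∈ α, -((k i * Real.pi : ℝ) : 𝕜)) * inner 𝕜 (cosL2 𝕜 a b k) (weakSobolev.toL2 u) := by
  induction α using Finset.induction_on with
  | empty =>
    rw [Finset.prod_empty, one_mul, indicatorIndex_empty, trigFactors_empty]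
    rfl
  | insert i α hi ih =>
    have hg : trigFactors a (insert i α) k i = sinFun a (k i) := by
      simp [trigFactors]
    have hw := (u.2 _ _ i (indicatorIndex_insert hr hi)).inner_tensorL2 (by linarith : a < b)
      (g := trigFactors a (insert i α) k) (g' := (k i * Real.pi) • cosFun a (k i))
      (fun j => by
        rw [trigFactors]
        split_ifs
        exacts [contDiff_sinFun _ _, contDiff_cosFun _ _])
      (fun t => by rw [hg, deriv_sinFun]) (by rw [hg, sinFun_left]) (by rw [hg, sinFun_right hab])
    have he : ∀ x, tensorProd (Function.update (trigFactors a (insert i α) k) i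
        ((k i * Real.pi) • cosFun a (k i))) x =
          (k i * Real.pi) * tensorProd (trigFactors a α k) x := fun x => by
      have : trigFactors a α k = Function.update (trigFactors a (insert i α) k) i
          (cosFun a (k i)) := funext fun j => by
        rcases eq_or_ne j i with rfl | hj
        · simp [trigFactors, hi]
        · simp [trigFactors, hj]
      rw [this, tensorProd_update, tensorProd_update, ContinuousMap.smul_apply, smul_eq_mul,
        mul_assoc]
    rw [hw, Finset.prod_insert hi, mul_assoc, ← ih, inner_tensorL2, inner_tensorL2]
    simp only [he]
    simp only [mul_smul ((k i : ℝ) * Real.pi)]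
    rw [integral_smul, neg_mul, RCLike.real_smul_eq_coe_mul]

/-- The univariate weight `1 + (kπ)²`. -/
noncomputable def cosWeight (k : ℕ) : ℝ := 1 + (k * Real.pi) ^ 2

theorem one_le_cosWeight (k : ℕ) : 1 ≤ cosWeight k := by
  rw [cosWeight]
  nlinarith [sq_nonneg ((k : ℝ) * Real.pi)]

/-- Bessel's inequality for `D^α u`. Indices outside the orthonormal system have some `k_i = 0` with
`i ∈ α`, so their terms on the left vanish. -/
theorem sum_sq_inner_trig_le (hab : b - a = 1) (hr : 1 ≤ r) (u : weakSobolev 𝕜 a b d r)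
    (α : Finset (Fin d)) (s : Finset (Fin d → ℕ)) :
    ∑ k ∈ s, (∏ i ∈ α, (k i * Real.pi) ^ 2) *
        ‖inner 𝕜 (cosL2 𝕜 a b k) (weakSobolev.toL2 u)‖ ^ 2 ≤
      ‖u.1 (indicatorIndex hr α)‖ ^ 2 := by
  classical
  have h1 : ∀ k : Fin d → ℕ, (∏ i ∈ α, (k i * Real.pi) ^ 2) *
      ‖inner 𝕜 (cosL2 𝕜 a b k) (weakSobolev.toL2 u)‖ ^ 2 =
        ‖inner 𝕜 (tensorL2 𝕜 a b (trigFactors a α k)) (u.1 (indicatorIndex hr α))‖ ^ 2 := fun k => by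
    rw [inner_trigFactors hab, norm_mul, mul_pow, norm_prod, ← Finset.prod_pow]
    congr 1
    exact Finset.prod_congr rfl fun i _ => by
      rw [norm_neg, RCLike.norm_ofReal, sq_abs]
  have h2 : ∑ k ∈ s, (∏ i ∈ α, (k i * Real.pi) ^ 2) *
      ‖inner 𝕜 (cosL2 𝕜 a b k) (weakSobolev.toL2 u)‖ ^ 2 =
        ∑ k ∈ s.subtype fun k => ∀ i ∈ α, k i ≠ 0,
          ‖inner 𝕜 (tensorL2 𝕜 a b (trigFactors a α k.1)) (u.1 (indicatorIndex hr α))‖ ^ 2 := by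
    simp only [← h1]
    rw [Finset.sum_subtype_eq_sum_filter (f := fun k : Fin d → ℕ => (∏ i ∈ α, (k i * Real.pi) ^ 2) *
      ‖inner 𝕜 (cosL2 𝕜 a b k) (weakSobolev.toL2 u)‖ ^ 2), Finset.sum_filter_of_ne]
    intro k _ hk i hi h0
    refine hk ?_
    rw [Finset.prod_eq_zero hi (by simp [h0]), zero_mul]
  rw [h2]
  exact (orthonormal_trig 𝕜 hab α).sum_inner_products_le _

/-- Expanding `∏ (1 + (k_i π)²)` over subsets `α` reduces this to the previous bound for each `α`.
Distinct subsets are distinct multi-indices, available as soon as `r ≥ 1`, so the sum of the right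
sides is part of `‖u‖²`. -/
theorem sum_weight_mul_sq_inner_le (hab : b - a = 1) (hr : 1 ≤ r) (u : weakSobolev 𝕜 a b d r)
    (s : Finset (Fin d → ℕ)) :
    ∑ k ∈ s, (∏ i, cosWeight (k i)) * ‖inner 𝕜 (cosL2 𝕜 a b k) (weakSobolev.toL2 u)‖ ^ 2 ≤
      ‖u‖ ^ 2 := by
  have h1 : ∀ k : Fin d → ℕ, ∏ i, cosWeight (k i) =
      ∑ α ∈ (Finset.univ : Finset (Fin d)).powerset, ∏ i ∈ α, (k i * Real.pi) ^ 2 := fun k => by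
    simp only [cosWeight]
    exact Finset.prod_one_add _
  simp only [h1, Finset.sum_mul]
  rw [Finset.sum_comm]
  refine (Finset.sum_le_sum fun α _ => sum_sq_inner_trig_le hab hr u α s).trans ?_
  have h2 := lp.sum_rpow_le_norm_rpow (p := 2) (by norm_num) u.1
    ((Finset.univ : Finset (Fin d)).powerset.map ⟨_, indicatorIndex_injective hr⟩)
  rw [Finset.sum_map] at h2
  simpa using h2

/-- Outside `K` the weights are at least `ε⁻²`, so the weighted Bessel inequality bounds the squared
coefficients there by `ε²` in total. The estimate is made for finite partial sums and passes to the
limit. -/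
theorem norm_sub_sum_cosL2_le (hab : b - a = 1) (hr : 1 ≤ r) {u : weakSobolev 𝕜 a b d r}
    (hu : ‖u‖ ≤ 1) {ε : ℝ} (hε : 0 ≤ ε) (K : Finset (Fin d → ℕ))
    (hK : ∀ k ∉ K, 1 ≤ ε ^ 2 * ∏ i, cosWeight (k i)) :
    ‖weakSobolev.toL2 u -
      ∑ k ∈ K, (inner 𝕜 (cosL2 𝕜 a b k) (weakSobolev.toL2 u) : 𝕜) • cosL2 𝕜 a b k‖ ≤ ε := by
  classical
  set f := weakSobolev.toL2 u with hf
  have ho := orthonormal_cosL2 𝕜 (d := d) hab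
  let B : HilbertBasis (Fin d → ℕ) 𝕜 (L2Cube 𝕜 a b d) := HilbertBasis.mkOfOrthogonalEqBot ho (by
    rw [Submodule.eq_bot_iff]
    intro g hg
    exact cosL2_complete hab fun k =>
      (Submodule.mem_orthogonal _ _).1 hg _ (Submodule.subset_span ⟨k, rfl⟩))
  have hB : ⇑B = cosL2 𝕜 a b := HilbertBasis.coe_mkOfOrthogonalEqBot ho _
  have hsum := B.hasSum_repr f
  simp only [HilbertBasis.repr_apply_apply, hB] at hsum
  refine le_of_tendsto (hsum.sub_const _ |> fun h => h.norm :
    Filter.Tendsto (fun s : Finset (Fin d → ℕ) =>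
      ‖∑ k ∈ s, (inner 𝕜 (cosL2 𝕜 a b k) f : 𝕜) • cosL2 𝕜 a b k -
        ∑ k ∈ K, (inner 𝕜 (cosL2 𝕜 a b k) f : 𝕜) • cosL2 𝕜 a b k‖) Filter.atTop _) ?_
  filter_upwards [Filter.eventually_ge_atTop K] with s hs
  rw [← Finset.sum_sdiff hs, add_sub_cancel_right]
  refine abs_le_of_sq_le_sq' ?_ hε |>.2
  rw [norm_sq_sum_smul_of_orthogonal (v := cosL2 𝕜 a b) fun i j hij => ho.2 hij]
  calc ∑ k ∈ s \ K, ‖(inner 𝕜 (cosL2 𝕜 a b k) f : 𝕜)‖ ^ 2 * ‖cosL2 𝕜 a b k‖ ^ 2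
      ≤ ∑ k ∈ s \ K, ε ^ 2 * ((∏ i, cosWeight (k i)) * ‖(inner 𝕜 (cosL2 𝕜 a b k) f : 𝕜)‖ ^ 2) := by
        refine Finset.sum_le_sum fun k hk => ?_
        rw [ho.1 k, one_pow, mul_one, ← mul_assoc]
        exact le_mul_of_one_le_left (sq_nonneg _) (hK k (Finset.mem_sdiff.1 hk).2)
    _ = ε ^ 2 * ∑ k ∈ s \ K, ((∏ i, cosWeight (k i)) *
          ‖(inner 𝕜 (cosL2 𝕜 a b k) f : 𝕜)‖ ^ 2) := by rw [Finset.mul_sum]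
    _ ≤ ε ^ 2 * ‖u‖ ^ 2 := by
        gcongr
        exact sum_weight_mul_sq_inner_le hab hr u _
    _ ≤ ε ^ 2 := mul_le_of_le_one_right (sq_nonneg _) (pow_le_one₀ (norm_nonneg _) hu)

/-- `APP` as a continuous linear map. -/
noncomputable def continuousAPP (𝕜 : Type*) [RCLike 𝕜] (a b : ℝ) (d : ℕ) (r : ℕ∞) :
    mixedSobolev 𝕜 a b d r →L[𝕜] L2Cube 𝕜 a b d :=
  (linearAPP 𝕜 a b d r).mkContinuous 1 fun f => by
    rw [one_mul]
    exact lp.norm_apply_le_norm two_ne_zero f.1.1 (MultiIndex.zero d r)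

/-- The upper bound obtained from the projection onto the span of finitely many cosines. -/
theorem mixedMinimalError_le (hab : b - a = 1) (hr : 1 ≤ r) {n : ℕ} {ε : ℝ} (hε : 0 ≤ ε)
    (K : Finset (Fin d → ℕ)) (hKn : K.card ≤ n)
    (hK : ∀ k ∉ K, 1 ≤ ε ^ 2 * ∏ i, cosWeight (k i)) :
    mixedMinimalError 𝕜 a b d r n ≤ ENNReal.ofReal ε := by
  have key := @minimalError_le 𝕜 _ (mixedSobolev 𝕜 a b d r) inferInstance inferInstance
    (L2Cube 𝕜 a b d) inferInstance inferInstance (APP 𝕜 a b d r) (Metric.closedBall 0 1) K.card n hKn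
    (fun j => (innerSL 𝕜 (cosL2 𝕜 a b (K.equivFin.symm j).1)).comp (continuousAPP 𝕜 a b d r))
    (fun j => cosL2 𝕜 a b (K.equivFin.symm j).1)
  refine key fun f hf => ?_
  have h := norm_sub_sum_cosL2_le hab hr (u := f.1) (mem_closedBall_zero_iff.1 hf) hε K hK
  rw [edist_dist, dist_eq_norm]
  refine ENNReal.ofReal_le_ofReal (le_of_eq_of_le ?_ h)
  congr 2
  rw [← Finset.sum_coe_sort K, ← K.equivFin.symm.sum_comp]
  rfl

end Projection

/-! ### Counting the cosines of small weight; the upper bound -/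

section UpperBound

/-- The number is `2 · 1.1929`: the constant of the upper exponent is half the logarithm of
`cosWeight 1`, rounded down. -/
theorem le_log_one_add_pi_sq : 2.3858 ≤ Real.log (1 + Real.pi ^ 2) := by
  have hpi : 10.8696 ≤ 1 + Real.pi ^ 2 := by
    nlinarith [Real.pi_gt_d6]
  rw [Real.le_log_iff_exp_le (by positivity)]
  have h1 : Real.exp 0.3858 ≤ 1.471 := by
    refine (Real.exp_bound' (by norm_num) (by norm_num) (n := 7) (by norm_num)).trans ?_
    norm_num [Finset.sum_range_succ, Nat.factorial]
  have h2 : Real.exp 2.3858 = Real.exp 1 * Real.exp 1 * Real.exp 0.3858 := by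
    rw [← Real.exp_add, ← Real.exp_add]
    norm_num
  have h3 : Real.exp 1 * Real.exp 1 ≤ 2.7182818286 * 2.7182818286 :=
    mul_le_mul Real.exp_one_lt_d9.le Real.exp_one_lt_d9.le (Real.exp_pos _).le (by norm_num)
  rw [h2]
  calc Real.exp 1 * Real.exp 1 * Real.exp 0.3858 ≤ 2.7182818286 * 2.7182818286 * 1.471 :=
        mul_le_mul h3 h1 (Real.exp_pos _).le (by norm_num)
    _ ≤ 1 + Real.pi ^ 2 := le_trans (by norm_num) hpi

theorem sum_inv_mul_sqrt_le (J : ℕ) :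
    ∑ j ∈ Finset.range J, 1 / (((j : ℝ) + 1) * √((j : ℝ) + 1)) ≤ 3 := by
  -- The subtracted term makes the induction telescope; it comes from comparing the sum with the
  -- integral of `x^(-3/2)`.
  suffices h : ∀ J : ℕ, ∑ j ∈ Finset.range (J + 1), 1 / (((j : ℝ) + 1) * √((j : ℝ) + 1)) ≤
      3 - 2 / √((J : ℝ) + 1) by
    rcases Nat.eq_zero_or_pos J with rfl | hJ
    · simp
    · obtain ⟨J, rfl⟩ := Nat.exists_eq_add_of_le' hJ
      exact (h J).trans (sub_le_self _ (by positivity))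
  intro J
  induction J with
  | zero => norm_num
  | succ J ih =>
    rw [Finset.sum_range_succ]
    push_cast
    set s := √((J : ℝ) + 1) with hs
    set t := √((J : ℝ) + 1 + 1) with ht
    have hs0 : 0 < s := Real.sqrt_pos.2 (by positivity)
    have hst : s ≤ t := Real.sqrt_le_sqrt (by linarith)
    have ht0 : 0 < t := hs0.trans_le hst
    have hs2 : s ^ 2 = J + 1 := Real.sq_sqrt (by positivity)
    have ht2 : t ^ 2 = J + 1 + 1 := Real.sq_sqrt (by positivity)
    have key : 1 / (((J : ℝ) + 1 + 1) * t) ≤ 2 / s - 2 / t := by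
      rw [← ht2, div_sub_div _ _ hs0.ne' ht0.ne', div_le_div_iff₀ (by positivity) (by positivity)]
      have h1 : (t - s) * (t + s) = 1 := by linear_combination ht2 - hs2
      have h2 : s * (t + s) ≤ 2 * t ^ 2 := by nlinarith
      have h3 : 0 ≤ t - s := sub_nonneg.2 hst
      calc 1 * (s * t) = t * (t - s) * (s * (t + s)) := by linear_combination -(s * t) * h1
        _ ≤ t * (t - s) * (2 * t ^ 2) := by gcongr
        _ = (2 * t - s * 2) * (t ^ 2 * t) := by ring
    linarith

/-- Since `1 + π² ≤ 1.12 π²`, the quotient is at most `1.12 / (j+1)²`; the exponent `3/4` turns this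
into the summable order `(j+1)^(-3/2)`. -/
theorem cosWeight_one_div_rpow_le (j : ℕ) :
    (cosWeight 1 / cosWeight (j + 1)) ^ (3 / 4 : ℝ) ≤
      1.12 * (1 / (((j : ℝ) + 1) * √((j : ℝ) + 1))) := by
  set m : ℝ := (j : ℝ) + 1 with hm
  have hm0 : 0 < m := by positivity
  have h1 : cosWeight 1 / cosWeight (j + 1) ≤ 1.12 / m ^ 2 := by
    rw [cosWeight, cosWeight, div_le_div_iff₀ (by positivity) (by positivity)]
    push_cast
    rw [← hm]
    have : 1 ≤ 0.12 * Real.pi ^ 2 := by nlinarith [Real.pi_gt_three]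
    nlinarith [sq_nonneg m]
  have h0 : 0 ≤ cosWeight 1 / cosWeight (j + 1) := by
    rw [cosWeight, cosWeight]; positivity
  calc (cosWeight 1 / cosWeight (j + 1)) ^ (3 / 4 : ℝ) ≤ (1.12 / m ^ 2) ^ (3 / 4 : ℝ) :=
        Real.rpow_le_rpow h0 h1 (by norm_num)
    _ = ((1.12 / m ^ 2) ^ 3) ^ (1 / 4 : ℝ) := by
        rw [← Real.rpow_natCast_mul (by positivity)]
        norm_num
    _ ≤ ((1.12 * (1 / (m * √m))) ^ 4) ^ (1 / 4 : ℝ) := by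
        refine Real.rpow_le_rpow (by positivity) ?_ (by norm_num)
        have : (√m) ^ 4 = m ^ 2 := by
          rw [show 4 = 2 * 2 from rfl, pow_mul, Real.sq_sqrt hm0.le]
        rw [mul_pow, div_pow, div_pow, mul_pow, this, one_pow, mul_one_div, ← pow_mul, ← pow_add]
        gcongr <;> norm_num
    _ = 1.12 * (1 / (m * √m)) := by
        rw [← Real.rpow_natCast_mul (by positivity)]
        norm_num

/-- The choice of `q` gives `cosWeight 1 ^ (-q) ≤ e⁻² / d ≤ 0.1354 / d`. The later terms decay at
least like `j^(-3/2)` relative to it because `q ≥ 3/4`, and `0.1354 · 1.12 · 3 < 0.46`. -/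
theorem sum_cosWeight_rpow_le {d : ℕ} (hd : 1 ≤ d) {q : ℝ}
    (hq : q = (2 + Real.log d) / (2 * 1.1929)) (J : ℕ) :
    ∑ j ∈ Finset.range J, cosWeight j ^ (-q) ≤ 1 + 0.46 / d := by
  have hd0 : (0 : ℝ) < d := by exact_mod_cast hd
  have hlog : 0 ≤ Real.log d := Real.log_nonneg (by exact_mod_cast hd)
  have hq1 : 3 / 4 ≤ q := by
    rw [hq, le_div_iff₀ (by norm_num)]
    linarith
  have hw : ∀ j, 0 < cosWeight j := fun j => zero_lt_one.trans_le (one_le_cosWeight j)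
  have hw1 : cosWeight 1 ^ (-q) ≤ 0.1354 / d := by
    have h1 : Real.log (cosWeight 1) = Real.log (1 + Real.pi ^ 2) := by simp [cosWeight]
    have h2 : 2 + Real.log d ≤ Real.log (cosWeight 1) * q := by
      have := mul_le_mul_of_nonneg_right le_log_one_add_pi_sq (by linarith : 0 ≤ q)
      rw [h1]
      refine le_trans (le_of_eq ?_) this
      rw [hq]
      ring
    rw [Real.rpow_def_of_pos (hw 1)]
    have h3 : Real.exp 2 * d ≤ Real.exp (Real.log (cosWeight 1) * q) := by
      rw [← Real.exp_log hd0, ← Real.exp_add]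
      exact Real.exp_le_exp.2 h2
    have h4 : 7.386 ≤ Real.exp 2 := by
      have : Real.exp 2 = Real.exp 1 * Real.exp 1 := by rw [← Real.exp_add]; norm_num
      rw [this]
      nlinarith [Real.exp_one_gt_d9]
    rw [mul_neg, Real.exp_neg, inv_le_comm₀ (Real.exp_pos _) (by positivity), inv_div]
    refine le_trans ?_ h3
    rw [div_le_iff₀ (by norm_num)]
    nlinarith
  have hj : ∀ j : ℕ, cosWeight (j + 1) ^ (-q) ≤
      0.1354 / d * (1.12 * (1 / (((j : ℝ) + 1) * √((j : ℝ) + 1)))) := fun j => by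
    have h1 : cosWeight (j + 1) ^ (-q) =
        cosWeight 1 ^ (-q) * (cosWeight 1 / cosWeight (j + 1)) ^ q := by
      rw [Real.div_rpow (hw 1).le (hw _).le, Real.rpow_neg (hw _).le, Real.rpow_neg (hw _).le]
      have := (Real.rpow_pos_of_pos (hw 1) q).ne'
      field_simp
    have h2 : cosWeight 1 / cosWeight (j + 1) ≤ 1 := by
      rw [div_le_one (hw _), cosWeight, cosWeight]
      gcongr
      simp
    rw [h1]
    refine mul_le_mul hw1 ?_ (Real.rpow_nonneg (div_nonneg (hw 1).le (hw _).le) _) (by positivity)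
    exact (Real.rpow_le_rpow_of_exponent_ge (div_pos (hw _) (hw _)) h2 hq1).trans
      (cosWeight_one_div_rpow_le j)
  rcases Nat.eq_zero_or_pos J with rfl | hJ
  · simp only [Finset.range_zero, Finset.sum_empty]; positivity
  obtain ⟨J, rfl⟩ := Nat.exists_eq_add_of_le' hJ
  rw [Finset.sum_range_succ', add_comm]
  refine add_le_add (by simp [cosWeight]) ?_
  refine (Finset.sum_le_sum fun j _ => hj j).trans ?_
  rw [← Finset.mul_sum, ← Finset.mul_sum]
  calc 0.1354 / d * (1.12 * ∑ j ∈ Finset.range J, 1 / (((j : ℝ) + 1) * √((j : ℝ) + 1)))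
      ≤ 0.1354 / d * (1.12 * 3) := by gcongr; exact sum_inv_mul_sqrt_le J
    _ ≤ 0.46 / d := by
      rw [div_mul_eq_mul_div]
      gcongr
      norm_num

theorem one_add_div_pow_le_two {d : ℕ} (hd : 1 ≤ d) : (1 + 0.46 / (d : ℝ)) ^ d ≤ 2 := by
  have hd0 : (0 : ℝ) < d := by exact_mod_cast hd
  calc (1 + 0.46 / (d : ℝ)) ^ d ≤ Real.exp (0.46 / d) ^ d := by
        gcongr
        rw [add_comm]
        exact Real.add_one_le_exp _
    _ = Real.exp 0.46 := by
        rw [← Real.exp_nat_mul, mul_div_cancel₀ _ hd0.ne']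
    _ ≤ Real.exp (Real.log 2) := Real.exp_le_exp.2 (by linarith [Real.log_two_gt_d9])
    _ = 2 := Real.exp_log two_pos

/-- The upper bound for the minimal error. -/
theorem mixedMinimalError_le_rpow (𝕜 : Type*) [RCLike 𝕜] {a b : ℝ} (hab : b - a = 1) {d : ℕ}
    (hd : 1 ≤ d) {r : ℕ∞} (hr : 1 ≤ r) (n : ℕ) :
    mixedMinimalError 𝕜 a b d r n ≤
      ENNReal.ofReal ((2 / ((n : ℝ) + 1)) ^ upperExponent d) := by
  classical
  set q : ℝ := (2 + Real.log d) / (2 * 1.1929) with hq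
  have hlog : 0 ≤ Real.log d := Real.log_nonneg (by exact_mod_cast hd)
  have hq0 : 0 < q := by positivity
  have hbase : 0 < 2 / ((n : ℝ) + 1) := by positivity
  set ε := (2 / ((n : ℝ) + 1)) ^ upperExponent d with hε
  have hε0 : 0 < ε := Real.rpow_pos_of_pos hbase _
  -- The exponent `q` is the reciprocal of `2 * upperExponent d`.
  have hεq : (ε ^ 2) ^ q = 2 / ((n : ℝ) + 1) := by
    rw [hε, ← Real.rpow_mul_natCast hbase.le, ← Real.rpow_mul hbase.le]
    have : upperExponent d * (2 : ℕ) * q = 1 := by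
      have : 2 + Real.log d ≠ 0 := by positivity
      rw [hq, upperExponent]
      push_cast
      field_simp
    rw [this, Real.rpow_one]
  have hw : ∀ k : Fin d → ℕ, 0 < ∏ i, cosWeight (k i) := fun k =>
    Finset.prod_pos fun i _ => zero_lt_one.trans_le (one_le_cosWeight _)
  -- A box containing all frequencies of weight below `ε⁻²`, since each `k i` is at most the whole
  -- product of weights; it only makes `K` finite.
  set J := ⌈(ε ^ 2)⁻¹⌉₊ with hJ
  set K := (Fintype.piFinset fun _ : Fin d => Finset.range J).filter
    fun k => ε ^ 2 * ∏ i, cosWeight (k i) < 1 with hK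
  refine mixedMinimalError_le hab hr hε0.le K ?_ ?_
  · rcases K.eq_empty_or_nonempty with h0 | hne
    · simp [h0]
    -- Every `k ∈ K` contributes more than `2/(n+1)` to a sum of at most `2`. Strictness is what
    -- gives `K.card < n + 1`, hence `K.card ≤ n`.
    have h1 : ∑ k ∈ K, 2 / ((n : ℝ) + 1) < ∑ k ∈ K, ∏ i, cosWeight (k i) ^ (-q) := by
      refine Finset.sum_lt_sum_of_nonempty hne fun k hk => ?_
      have hk1 := (Finset.mem_filter.1 hk).2
      rw [Real.finsetProd_rpow _ _ fun i _ => zero_le_one.trans (one_le_cosWeight _),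
        Real.rpow_neg (hw k).le, ← hεq, lt_inv_comm₀ (by positivity) (Real.rpow_pos_of_pos (hw k) _),
        ← Real.inv_rpow (by positivity)]
      refine Real.rpow_lt_rpow (hw k).le ?_ hq0
      rwa [lt_inv_comm₀ (hw k) (by positivity), ← one_div, lt_div_iff₀ (hw k)]
    have h2 : ∑ k ∈ K, ∏ i, cosWeight (k i) ^ (-q) ≤ 2 := by
      calc ∑ k ∈ K, ∏ i, cosWeight (k i) ^ (-q)
          ≤ ∑ k ∈ Fintype.piFinset fun _ : Fin d => Finset.range J,
              ∏ i, cosWeight (k i) ^ (-q) :=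
            Finset.sum_le_sum_of_subset_of_nonneg (Finset.filter_subset _ _) fun k _ _ =>
              Finset.prod_nonneg fun i _ =>
                Real.rpow_nonneg (zero_le_one.trans (one_le_cosWeight _)) _
        _ = (∑ j ∈ Finset.range J, cosWeight j ^ (-q)) ^ d := by
            rw [← Finset.prod_univ_sum (fun _ => Finset.range J) fun _ j => cosWeight j ^ (-q),
              Finset.prod_const, Finset.card_univ, Fintype.card_fin]
        _ ≤ (1 + 0.46 / d) ^ d := by
            refine pow_le_pow_left₀ (Finset.sum_nonneg fun j _ =>
              Real.rpow_nonneg (zero_le_one.trans (one_le_cosWeight _)) _) ?_ d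
            exact sum_cosWeight_rpow_le hd hq J
        _ ≤ 2 := one_add_div_pow_le_two hd
    have h3 := h1.trans_le h2
    rw [Finset.sum_const, nsmul_eq_mul, mul_div_assoc', div_lt_iff₀ (by positivity)] at h3
    have h4 : (K.card : ℝ) < n + 1 := by linarith
    exact Nat.lt_succ_iff.1 (by exact_mod_cast h4)
  · intro k hk
    by_contra! hlt
    refine hk (Finset.mem_filter.2 ⟨Fintype.mem_piFinset.2 fun i => Finset.mem_range.2 ?_, hlt⟩)
    rw [hJ, Nat.lt_ceil]
    have h1 : cosWeight (k i) ≤ ∏ i, cosWeight (k i) := by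
      rw [← Finset.mul_prod_erase _ _ (Finset.mem_univ i)]
      refine le_mul_of_one_le_right (zero_le_one.trans (one_le_cosWeight _)) ?_
      exact Finset.one_le_prod fun j _ => one_le_cosWeight _
    have h2 : (k i : ℝ) ≤ cosWeight (k i) := by
      rw [cosWeight]
      have h3 : (k i : ℝ) ≤ k i * Real.pi :=
        le_mul_of_one_le_right (Nat.cast_nonneg _) (by linarith [Real.pi_gt_three])
      nlinarith [sq_nonneg ((k i : ℝ) * Real.pi - 1)]
    refine (h2.trans h1).trans_lt ?_
    rwa [lt_inv_comm₀ (hw k) (by positivity), ← one_div, lt_div_iff₀ (hw k)]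

end UpperBound

/-! ### Counting the Legendre products of small norm -/

section Counting

/-- The number of subsets with fewer than `L` elements of a set with `d` elements. -/
def chooseSum (d L : ℕ) : ℕ := ∑ k ∈ Finset.range L, d.choose k

theorem chooseSum_succ_right (d L : ℕ) : chooseSum d (L + 1) = chooseSum d L + d.choose L :=
  Finset.sum_range_succ _ _

theorem chooseSum_succ_left (d L : ℕ) :
    chooseSum (d + 1) L = chooseSum d L + chooseSum d (L - 1) := by
  induction L with
  | zero => rfl
  | succ L ih =>
    rw [chooseSum_succ_right, ih, chooseSum_succ_right, Nat.add_sub_cancel]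
    rcases L with _ | L
    · simp [chooseSum]
    · rw [Nat.choose_succ_succ, Nat.add_sub_cancel, chooseSum_succ_right d L]
      ring

theorem chooseSum_mono_right (d : ℕ) : Monotone (chooseSum d) := fun _ _ h =>
  Finset.sum_le_sum_of_subset (Finset.range_mono h)

theorem chooseSum_mono_left (L : ℕ) : Monotone fun d => chooseSum d L := fun _ _ h =>
  Finset.sum_le_sum fun k _ => Nat.choose_le_choose k h

theorem chooseSum_add_reflect {d j : ℕ} (hj : j ≤ d + 1) :
    chooseSum d j + chooseSum d (d + 1 - j) = 2 ^ d := by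
  obtain ⟨i, hi⟩ := Nat.exists_eq_add_of_le hj
  rw [hi, Nat.add_sub_cancel_left, ← Nat.sum_range_choose d, hi, Finset.sum_range_add]
  congr 1
  rw [chooseSum, ← Finset.sum_range_reflect]
  refine Finset.sum_congr rfl fun k hk => ?_
  have := Finset.mem_range.1 hk
  exact Nat.choose_symm_of_eq_add (by omega)

theorem two_pow_le_chooseSum {d L : ℕ} (h : d < L) : 2 ^ d ≤ chooseSum d L := by
  rw [← Nat.sum_range_choose d]
  exact chooseSum_mono_right d h

theorem chooseSum_halfway (m : ℕ) : chooseSum (2 * m + 1) (m + 1) = 4 ^ m :=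
  Nat.sum_range_choose_halfway m

/-- Upper bounds for `log₁₃` of the weights of the Legendre polynomials. -/
def legendreCost : Fin 3 → ℕ := ![0, 1, 3]

theorem legendreWeight_le (k : Fin 3) : legendreWeight k ≤ 13 ^ legendreCost k := by
  revert k
  decide

/-- The number of index vectors of total cost less than `L`. -/
def costCount (d L : ℕ) : ℕ :=
  (Finset.univ.filter fun α : Fin d → Fin 3 => ∑ i, legendreCost (α i) < L).card

/-- Condition on the first entry. Truncated subtraction is harmless, since no vector has total cost
less than `0`. -/
theorem costCount_succ_left (d L : ℕ) :
    costCount (d + 1) L = costCount d L + costCount d (L - 1) + costCount d (L - 3) := by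
  simp only [costCount, Finset.card_filter]
  rw [← (Fin.consEquiv fun _ : Fin (d + 1) => Fin 3).sum_comp, Fintype.sum_prod_type,
    Fin.sum_univ_three]
  have h : ∀ (j : Fin 3) (c : ℕ), legendreCost j = c → ∀ α : Fin d → Fin 3,
      (∑ i, legendreCost (Fin.consEquiv (fun _ : Fin (d + 1) => Fin 3) (j, α) i) < L) =
        (∑ i, legendreCost (α i) < L - c) := fun j c hc α => by
    rw [Fin.sum_univ_succ]
    simp only [Fin.consEquiv_apply, Fin.cons_zero, Fin.cons_succ, hc, eq_iff_iff]
    omega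
  simp only [h 0 0 rfl, h 1 1 rfl, h 2 3 rfl, Nat.sub_zero]

theorem costCount_zero_right (d : ℕ) : costCount d 0 = 0 := by
  simp [costCount]

/-- The two terms count the vectors with entries in `{0,1}` and those with exactly one entry `2`,
which can stand in `d` places and costs `3`. -/
theorem chooseSum_add_le_costCount (d L : ℕ) :
    chooseSum d L + d * chooseSum (d - 1) (L - 3) ≤ costCount d L := by
  induction d generalizing L with
  | zero =>
    rcases L with _ | L
    · simp [chooseSum]
    · have : chooseSum 0 (L + 1) = 1 := by
        rw [chooseSum, Finset.sum_range_succ']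
        simp
      simp [this, costCount]
  | succ d ih =>
    have h1 := ih L
    have h2 := ih (L - 1)
    have h3 := (Nat.le_add_right _ _).trans (ih (L - 3))
    have h4 : (d + 1) * chooseSum d (L - 3) = d * chooseSum (d - 1) (L - 3) +
        d * chooseSum (d - 1) (L - 1 - 3) + chooseSum d (L - 3) := by
      rcases d with _ | d
      · simp
      · rw [add_mul, one_mul]
        congr 1
        rw [chooseSum_succ_left d, mul_add, Nat.add_sub_cancel, Nat.sub_right_comm]
    rw [costCount_succ_left, chooseSum_succ_left, Nat.add_sub_cancel, h4]
    omega

theorem chooseSum_le_costCount (d L : ℕ) : chooseSum d L ≤ costCount d L :=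
  (Nat.le_add_right _ _).trans (chooseSum_add_le_costCount d L)

theorem costCount_le_card (d l : ℕ) : costCount d (l + 1) ≤
    (Finset.univ.filter fun α : Fin d → Fin 3 => ∏ i, legendreWeight (α i) ≤ 13 ^ l).card := by
  refine Finset.card_le_card fun α hα => ?_
  rw [Finset.mem_filter] at hα ⊢
  refine ⟨hα.1, ?_⟩
  calc ∏ i, legendreWeight (α i) ≤ ∏ i, 13 ^ legendreCost (α i) :=
        Finset.prod_le_prod' fun i _ => legendreWeight_le _
    _ = 13 ^ ∑ i, legendreCost (α i) := Finset.prod_pow_eq_pow_sum _ _ _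
    _ ≤ 13 ^ l := Nat.pow_le_pow_right (by norm_num) (Nat.lt_succ_iff.1 hα.2)

/-- By symmetry of the binomial coefficients, `2^d` exceeds the partial sum by the short sum
`chooseSum d (d - l)`; the vectors with one entry `2` make up for it. -/
theorem two_pow_le_costCount {d l : ℕ} (h : d + 2 ≤ 2 * l) : 2 ^ d ≤ costCount d (l + 1) := by
  rcases lt_or_ge d l with hdl | hdl
  · exact (two_pow_le_chooseSum (by omega)).trans (chooseSum_le_costCount _ _)
  refine le_trans ?_ (chooseSum_add_le_costCount _ _)
  rw [← chooseSum_add_reflect (show l + 1 ≤ d + 1 by omega)]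
  gcongr
  obtain ⟨e, rfl⟩ : ∃ e, d = e + 1 := ⟨d - 1, by omega⟩
  rw [chooseSum_succ_left, Nat.add_sub_cancel]
  have h1 : chooseSum e (e + 1 + 1 - (l + 1)) ≤ chooseSum e (l + 1 - 3) :=
    chooseSum_mono_right e (by omega)
  have h2 : chooseSum e (e + 1 + 1 - (l + 1) - 1) ≤ chooseSum e (l + 1 - 3) :=
    chooseSum_mono_right e (by omega)
  have h3 : 2 * chooseSum e (l + 1 - 3) ≤ (e + 1) * chooseSum e (l + 1 - 3) :=
    Nat.mul_le_mul_right _ (by omega)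
  omega

/-- Same compensation as before. Here the missing sum contains one further binomial coefficient, at
most four times its predecessor, so six copies of `chooseSum (2p+2) p` suffice and `2p+3 ≥ 7` are
available. -/
theorem two_pow_le_costCount_of_odd {p : ℕ} (hp : 2 ≤ p) :
    2 ^ (2 * p + 3) ≤ costCount (2 * p + 3) (p + 3) := by
  refine le_trans ?_ (chooseSum_add_le_costCount _ _)
  rw [← chooseSum_add_reflect (show p + 3 ≤ 2 * p + 3 + 1 by omega)]
  gcongr
  rw [show 2 * p + 3 + 1 - (p + 3) = p + 1 by omega, show 2 * p + 3 - 1 = 2 * p + 2 by omega,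
    show 2 * p + 3 = 2 * p + 2 + 1 by omega, chooseSum_succ_left, Nat.add_sub_cancel,
    Nat.add_sub_cancel, chooseSum_succ_right]
  obtain ⟨q, rfl⟩ : ∃ q, p = q + 1 := ⟨p - 1, by omega⟩
  set N := 2 * (q + 1) + 2 with hN
  have h1 : N.choose (q + 1) * (q + 1) = N.choose q * (N - q) := Nat.choose_succ_right_eq N q
  have h2 : N.choose (q + 1) ≤ 4 * N.choose q := by
    refine Nat.le_of_mul_le_mul_right (c := q + 1) ?_ (Nat.succ_pos q)
    rw [h1, mul_comm 4, mul_assoc]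
    exact Nat.mul_le_mul_left _ (by omega)
  have h3 : N.choose q ≤ chooseSum N (q + 1) := by
    rw [chooseSum_succ_right]
    exact Nat.le_add_left _ _
  have h4 : 7 * chooseSum N (q + 1) ≤ (N + 1) * chooseSum N (q + 1) :=
    Nat.mul_le_mul_right _ (by omega)
  omega

/-- Factor by factor, `(l - j)/l ≤ (d - j)/d`. -/
theorem choose_mul_pow_le {l d : ℕ} (h : l ≤ d) (k : ℕ) :
    l.choose k * d ^ k ≤ d.choose k * l ^ k := by
  have h1 : l.descFactorial k * d ^ k ≤ d.descFactorial k * l ^ k := by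
    induction k with
    | zero => simp
    | succ k ih =>
      rw [Nat.descFactorial_succ, Nat.descFactorial_succ, pow_succ, pow_succ]
      have h2 : (l - k) * d ≤ (d - k) * l := by
        rw [Nat.sub_mul, Nat.sub_mul, mul_comm d l]
        exact Nat.sub_le_sub_left (Nat.mul_le_mul_left k h) _
      calc (l - k) * l.descFactorial k * (d ^ k * d)
          = (l - k) * d * (l.descFactorial k * d ^ k) := by ring
        _ ≤ (d - k) * l * (d.descFactorial k * l ^ k) := Nat.mul_le_mul h2 ih
        _ = (d - k) * d.descFactorial k * (l ^ k * l) := by ring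
  rw [Nat.descFactorial_eq_factorial_mul_choose, Nat.descFactorial_eq_factorial_mul_choose,
    mul_assoc, mul_assoc] at h1
  exact Nat.le_of_mul_le_mul_left h1 (Nat.factorial_pos k)

theorem one_add_div_pow_le_chooseSum {l d : ℕ} (hl : 0 < l) (h : l ≤ d) :
    (1 + (d : ℝ) / l) ^ l ≤ chooseSum d (l + 1) := by
  rw [add_comm, add_pow, chooseSum]
  push_cast
  refine Finset.sum_le_sum fun k _ => ?_
  have h1 : (l.choose k : ℝ) * d ^ k ≤ d.choose k * l ^ k := by
    exact_mod_cast choose_mul_pow_le h k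
  rw [one_pow, mul_one, div_pow, div_mul_eq_mul_div, div_le_iff₀ (by positivity), mul_comm]
  exact h1

theorem le_logb_two {m p q : ℕ} (hm : 0 < m) (hq : 0 < q) (h : 2 ^ p ≤ m ^ q) :
    (p : ℝ) / q ≤ Real.logb 2 m := by
  have hm' : (0 : ℝ) < m := by exact_mod_cast hm
  rw [div_le_iff₀ (by exact_mod_cast hq), mul_comm, ← Real.logb_pow,
    Real.le_logb_iff_rpow_le one_lt_two (by positivity), Real.rpow_natCast]
  exact_mod_cast h

theorem one_add_div_logb_pow_le {d l m : ℕ} {y B : ℝ} (hy0 : 0 < y) (hy : y ≤ Real.logb 2 m)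
    (h : (1 + 2 * d / y) ^ l ≤ B) (hB : B ≤ m) : (1 + 2 * d / Real.logb 2 m) ^ l ≤ m := by
  refine le_trans ?_ (h.trans hB)
  have := hy0.trans_le hy
  gcongr

/-- The counting estimate behind the lower bound. -/
theorem one_add_div_logb_pow_le_of_costCount_lt {d l m : ℕ} (hd : 1 ≤ d) (hm2 : m ≤ 2 ^ d)
    (hm : costCount d (l + 1) < m) (hne : ¬ (d = 3 ∧ m = 8)) :
    (1 + 2 * d / Real.logb 2 m) ^ l ≤ m := by
  have hm0 : 0 < m := by omega
  rcases Nat.eq_zero_or_pos l with rfl | hl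
  · rw [pow_zero]
    exact_mod_cast hm0
  have hS := (chooseSum_le_costCount d (l + 1)).trans_lt hm
  have hT := (chooseSum_add_le_costCount d (l + 1)).trans_lt hm
  -- For large `l` the count already reaches `2^d ≥ m`, a contradiction.
  rcases le_or_gt (d + 2) (2 * l) with h1 | h1
  · exact absurd (two_pow_le_costCount h1) (by omega)
  -- Here `m ≥ 4^l`, so `log₂ m ≥ 2l` and the base is at most `1 + d/l`, whose `l`-th power is
  -- bounded by the binomial sum. The remaining cases are `d = 2l - 1` and `d = 2l`.
  rcases le_or_gt (2 * l + 1) d with h2 | h2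
  · have h3 : 4 ^ l ≤ m := by
      rw [← chooseSum_halfway]
      exact (chooseSum_mono_left _ h2).trans hS.le
    have h4 := le_logb_two (p := 2 * l) hm0 one_pos (by rw [pow_mul, pow_one]; exact h3)
    refine one_add_div_logb_pow_le (y := 2 * l) (by positivity) (by simpa using h4) ?_
      (B := chooseSum d (l + 1)) (by exact_mod_cast hS.le)
    rw [mul_div_mul_left _ _ two_ne_zero]
    exact one_add_div_pow_le_chooseSum hl (by omega)
  rcases Nat.lt_or_ge l 4 with h3 | h3
  · have h4 : d = 2 * l - 1 ∨ d = 2 * l := by omega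
    interval_cases l
    · rcases h4 with rfl | rfl
      · have : chooseSum (2 * 1 - 1) (1 + 1) = 2 := by decide
        omega
      · have e : chooseSum (2 * 1) (1 + 1) = 3 := by decide
        have h5 := le_logb_two (p := 2) (q := 1) hm0 one_pos (by rw [pow_one]; omega)
        have h6 : (4 : ℝ) ≤ m := by exact_mod_cast (by omega : 4 ≤ m)
        exact one_add_div_logb_pow_le (by norm_num) h5 (by norm_num) h6 (B := 4)
    · rcases h4 with rfl | rfl
      · have e : chooseSum (2 * 2 - 1) (2 + 1) = 7 := by decide
        omega
      · have e : chooseSum (2 * 2) (2 + 1) = 11 := by decide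
        have h7 : 12 ≤ m := by omega
        have h5 := le_logb_two (p := 7) (q := 2) hm0 two_pos
          (le_trans (by norm_num) (Nat.pow_le_pow_left h7 2))
        have h6 : (12 : ℝ) ≤ m := by exact_mod_cast h7
        exact one_add_div_logb_pow_le (by norm_num) h5 (by norm_num) h6 (B := 12)
    · rcases h4 with rfl | rfl
      · have e : chooseSum (2 * 3 - 1) (3 + 1) +
            (2 * 3 - 1) * chooseSum (2 * 3 - 1 - 1) (3 + 1 - 3) = 31 := by decide
        have h7 : 32 ≤ m := by omega
        have h5 := le_logb_two (p := 5) (q := 1) hm0 one_pos (by rw [pow_one]; omega)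
        have h6 : (32 : ℝ) ≤ m := by exact_mod_cast h7
        exact one_add_div_logb_pow_le (by norm_num) h5 (by norm_num) h6 (B := 32)
      · have e : chooseSum (2 * 3) (3 + 1) = 42 := by decide
        have h7 : 43 ≤ m := by omega
        have h5 := le_logb_two (p := 5) (q := 1) hm0 one_pos (by rw [pow_one]; omega)
        have h6 : (43 : ℝ) ≤ m := by exact_mod_cast h7
        exact one_add_div_logb_pow_le (by norm_num) h5 (by norm_num) h6 (B := 43)
  rcases (by omega : d = 2 * l - 1 ∨ d = 2 * l) with h4 | h4
  · obtain ⟨p, rfl⟩ : ∃ p, l = p + 2 := ⟨l - 2, by omega⟩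
    obtain rfl : d = 2 * p + 3 := by omega
    exact absurd ((two_pow_le_costCount_of_odd (p := p) (by omega)).trans_lt hm) (not_lt.2 hm2)
  · subst h4
    obtain ⟨e, rfl⟩ : ∃ e, l = e + 1 := ⟨l - 1, by omega⟩
    have h5 : 2 * 4 ^ e ≤ chooseSum (2 * (e + 1)) (e + 1 + 1) := by
      rw [show 2 * (e + 1) = 2 * e + 1 + 1 by ring, chooseSum_succ_left, Nat.add_sub_cancel,
        ← chooseSum_halfway]
      have := chooseSum_mono_right (2 * e + 1) (show e + 1 ≤ e + 1 + 1 by omega)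
      omega
    have h6 := le_logb_two (p := 2 * e + 1) hm0 one_pos (by
      rw [pow_succ, pow_mul, mul_comm, pow_one]; exact h5.trans hS.le)
    have h7 : (2 * 4 ^ e : ℝ) ≤ m := by exact_mod_cast h5.trans hS.le
    refine one_add_div_logb_pow_le (y := 2 * e + 1) (by positivity) (by simpa using h6) ?_ h7
    have he : (3 : ℝ) ≤ e := by exact_mod_cast (by omega : 3 ≤ e)
    -- The value at `e = 3`, where the left side is largest. As `23/7 < 4`, the claim follows from
    -- `(23/7)^4 ≤ 2 · 4^3`.
    have h8 : 1 + 2 * ((2 * (e + 1) : ℕ) : ℝ) / (2 * e + 1) ≤ 23 / 7 := by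
      rw [← le_sub_iff_add_le', div_le_iff₀ (by positivity)]
      push_cast
      linarith
    have h9 : ∀ j : ℕ, (23 / 7 : ℝ) ^ (j + 4) ≤ 2 * 4 ^ (j + 3) := fun j => by
      rw [pow_add, pow_add, mul_left_comm]
      refine mul_le_mul (pow_le_pow_left₀ (by norm_num) (by norm_num) j) (by norm_num)
        (by positivity) (by positivity)
    obtain ⟨j, rfl⟩ : ∃ j, e = j + 3 := ⟨e - 3, by omega⟩
    exact (pow_le_pow_left₀ (by positivity) h8 _).trans (h9 j)

end Counting

/-! ### Numerical constants and the lower bound -/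

section LowerBound

/-- The constant of the lower exponent is half the logarithm of `13`, rounded up. -/
theorem sqrt_thirteen_le_exp : √13 ≤ Real.exp 1.2825 := by
  rw [Real.sqrt_le_left (Real.exp_pos _).le, ← Real.exp_nat_mul]
  have h1 : Real.exp ((2 : ℕ) * 1.2825) = Real.exp 1 * Real.exp 1 * Real.exp 0.565 := by
    rw [← Real.exp_add, ← Real.exp_add]
    norm_num
  have h2 : 1.7594 ≤ Real.exp 0.565 := by
    refine le_trans ?_ (Real.sum_le_exp_of_nonneg (by norm_num) 8)
    norm_num [Finset.sum_range_succ, Nat.factorial]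
  have h3 : 2.7182818283 * 2.7182818283 ≤ Real.exp 1 * Real.exp 1 :=
    mul_le_mul Real.exp_one_gt_d9.le Real.exp_one_gt_d9.le (by norm_num) (Real.exp_pos _).le
  rw [h1]
  calc (13 : ℝ) ≤ 2.7182818283 * 2.7182818283 * 1.7594 := by norm_num
    _ ≤ _ := mul_le_mul h3 h2 (by norm_num) (by positivity)

/-- The precision is chosen so that `1.2825 / 1.0962 ≤ 1.17`. -/
theorem le_log_three : 1.0962 ≤ Real.log 3 := by
  rw [Real.le_log_iff_exp_le (by norm_num)]
  have h1 : Real.exp 0.0962 ≤ 1.102 := by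
    refine (Real.exp_bound' (by norm_num) (by norm_num) (n := 3) (by norm_num)).trans ?_
    norm_num [Finset.sum_range_succ, Nat.factorial]
  have h2 : Real.exp 1.0962 = Real.exp 1 * Real.exp 0.0962 := by
    rw [← Real.exp_add]
    norm_num
  rw [h2]
  calc Real.exp 1 * Real.exp 0.0962 ≤ 2.7182818286 * 1.102 :=
        mul_le_mul Real.exp_one_lt_d9.le h1 (Real.exp_pos _).le (by norm_num)
    _ ≤ 3 := by norm_num

theorem three_le_one_add_div_logb {d m : ℕ} (hm : 2 ≤ m) (hm2 : m ≤ 2 ^ d) :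
    3 ≤ 1 + 2 * d / Real.logb 2 m := by
  have hm1 : (1 : ℝ) < m := by exact_mod_cast hm
  have h0 : 0 < Real.logb 2 m := Real.logb_pos one_lt_two hm1
  have h1 : Real.logb 2 m ≤ d := by
    rw [Real.logb_le_iff_le_rpow one_lt_two (by linarith), Real.rpow_natCast]
    exact_mod_cast hm2
  have : 2 ≤ 2 * d / Real.logb 2 m := by
    rw [le_div_iff₀ h0]
    linarith
  linarith

theorem lowerExponent_le {d m : ℕ} (hm : 2 ≤ m) (hm2 : m ≤ 2 ^ d) : lowerExponent d m ≤ 1.17 := by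
  have h := Real.log_le_log (by norm_num) (three_le_one_add_div_logb hm hm2)
  have h3 := le_log_three
  rw [lowerExponent, div_le_iff₀ (by linarith)]
  linarith

/-- Taking logarithms in the counting estimate gives `√13 ^ l ≤ exp (1.2825 l) ≤ m ^ lowerExponent d
m`. The one extra factor `√13` is paid for by `0.27`. -/
theorem mul_rpow_neg_lowerExponent_le {d l m : ℕ} (hm : 2 ≤ m) (hm2 : m ≤ 2 ^ d)
    (h : (1 + 2 * d / Real.logb 2 m) ^ l ≤ m) :
    0.27 * (m : ℝ) ^ (-lowerExponent d m) ≤ (√((13 ^ (l + 1) : ℕ) : ℝ))⁻¹ := by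
  have hQ := three_le_one_add_div_logb hm hm2
  set Q := 1 + 2 * d / Real.logb 2 m with hQdef
  have hm0 : (0 : ℝ) < m := by exact_mod_cast (by omega : 0 < m)
  have hlQ : 0 < Real.log Q := Real.log_pos (by linarith)
  have h1 : l * Real.log Q ≤ Real.log m := by
    rw [← Real.log_pow]
    exact Real.log_le_log (by positivity) h
  have h2 : 1.2825 * l ≤ Real.log m * lowerExponent d m := by
    rw [lowerExponent, ← hQdef, mul_div_assoc', le_div_iff₀ hlQ]
    linarith
  have h3 : √13 ^ l ≤ (m : ℝ) ^ lowerExponent d m := by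
    rw [Real.rpow_def_of_pos hm0]
    refine le_trans ?_ (Real.exp_le_exp.2 h2)
    rw [mul_comm, Real.exp_nat_mul]
    exact pow_le_pow_left₀ (Real.sqrt_nonneg _) sqrt_thirteen_le_exp l
  have h4 : √((13 ^ (l + 1) : ℕ) : ℝ) = √13 ^ l * √13 := by
    push_cast
    rw [← pow_succ, Real.sqrt_eq_iff_mul_self_eq (by positivity) (by positivity), ← mul_pow,
      Real.mul_self_sqrt (by norm_num)]
  have h5 : 0.27 * √13 ≤ 1 := by
    rw [← le_div_iff₀' (by norm_num), Real.sqrt_le_left (by norm_num)]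
    norm_num
  rw [h4, Real.rpow_neg hm0.le, mul_inv, mul_comm]
  gcongr
  rwa [le_inv_comm₀ (by norm_num) (by positivity), ← one_div, le_div_iff₀' (by norm_num)]

/-- The lower bound for the minimal error. -/
theorem rpow_le_mixedMinimalError (𝕜 : Type*) [RCLike 𝕜] {a b : ℝ} (hab : b - a = 1) {d : ℕ}
    (hd : 1 ≤ d) (r : ℕ∞) {n : ℕ} (hdn : d ≤ n) (hn : n < 2 ^ d) :
    ENNReal.ofReal (0.27 * ((n : ℝ) + 1) ^ (-lowerExponent d (n + 1))) ≤
      mixedMinimalError 𝕜 a b d r n := by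
  -- For `l = 2` the counting estimate would read `3² ≤ 8` here. The true norm bound `781`, in place
  -- of `13³`, leaves ample room.
  by_cases hne : d = 3 ∧ n + 1 = 8
  · obtain ⟨rfl, hn8⟩ := hne
    obtain rfl : n = 7 := by omega
    refine le_trans (ENNReal.ofReal_le_ofReal ?_)
      (le_mixedMinimalError (𝕜 := 𝕜) (r := r) hab (n := 7) (C := 781) (by decide))
    have h1 : 1 ≤ lowerExponent 3 (7 + 1) := by
      have h8 : Real.logb 2 ((7 + 1 : ℕ) : ℝ) = 3 := by
        rw [show ((7 + 1 : ℕ) : ℝ) = 2 ^ (3 : ℕ) by norm_num, Real.logb_pow,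
          Real.logb_self_eq_one one_lt_two]
        norm_num
      rw [lowerExponent, h8, show 1 + 2 * ((3 : ℕ) : ℝ) / 3 = 3 by norm_num,
        one_le_div (Real.log_pos (by norm_num)), Real.log_le_iff_le_exp (by norm_num)]
      refine le_trans ?_ sqrt_thirteen_le_exp
      rw [Real.le_sqrt' (by norm_num)]
      norm_num
    have h2 : ((7 : ℕ) + 1 : ℝ) ^ (-lowerExponent 3 (7 + 1)) ≤ 1 / 8 := by
      refine (Real.rpow_le_rpow_of_exponent_le (by norm_num) (neg_le_neg h1)).trans ?_
      rw [Real.rpow_neg_one]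
      norm_num
    have h3 : √((781 : ℕ) : ℝ) ≤ 28 := by
      rw [Real.sqrt_le_left (by norm_num)]
      norm_num
    have h4 : (28 : ℝ)⁻¹ ≤ (√((781 : ℕ) : ℝ))⁻¹ := inv_anti₀ (by positivity) h3
    refine le_trans ?_ h4
    linarith
  -- The least such `L = l + 1` gives more than `n` products of squared norm at most `13^l`, while
  -- minimality gives `costCount d l < n + 1`, the input of the counting estimate with `l - 1`.
  · have hex : ∃ L, n + 1 ≤ costCount d L :=
      ⟨d + 1, hn.trans_le ((two_pow_le_chooseSum d.lt_succ_self).trans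
        (chooseSum_le_costCount _ _))⟩
    classical
    obtain ⟨l, hl⟩ : ∃ l, Nat.find hex = l + 1 :=
      Nat.exists_eq_succ_of_ne_zero fun h0 => by
        have := Nat.find_spec hex
        rw [h0, costCount_zero_right] at this
        omega
    have hspec := Nat.find_spec hex
    rw [hl] at hspec
    have hcard := hspec.trans (costCount_le_card d l)
    have hmin := Nat.find_min hex (m := l) (by omega)
    refine le_trans (ENNReal.ofReal_le_ofReal ?_)
      (le_mixedMinimalError (𝕜 := 𝕜) (r := r) hab hcard)
    rcases l with _ | l
    · have h1 : (n : ℝ) + 1 = ((n + 1 : ℕ) : ℝ) := by push_cast; rfl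
      have h2 : (1 : ℝ) ≤ n + 1 := by linarith [(Nat.cast_nonneg n : (0 : ℝ) ≤ n)]
      have h3 : 0 ≤ lowerExponent d (n + 1) := by
        rw [lowerExponent]
        have := three_le_one_add_div_logb (d := d) (m := n + 1) (by omega) hn
        exact div_nonneg (by norm_num) (Real.log_nonneg (by linarith))
      have h4 := Real.rpow_le_one_of_one_le_of_nonpos h2 (neg_nonpos.2 h3)
      simp only [pow_zero, Nat.cast_one, Real.sqrt_one, inv_one]
      linarith
    · have key := mul_rpow_neg_lowerExponent_le (m := n + 1) (by omega) hn
        (one_add_div_logb_pow_le_of_costCount_lt hd hn (not_le.1 hmin) hne)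
      simpa only [Nat.cast_add, Nat.cast_one] using key

end LowerBound

end MixedSobolev

theorem mainTheorem5 {𝕜 : Type*} [RCLike 𝕜] (a b : ℝ) (hab : b - a = 1)
    (d : ℕ) (hd : 1 ≤ d) (r : ℕ∞) (hr : 1 ≤ r) :
    (∀ n : ℕ, MixedSobolev.mixedMinimalError 𝕜 a b d r n ≤
      ENNReal.ofReal ((2 / ((n : ℝ) + 1)) ^ MixedSobolev.upperExponent d)) ∧
    (∀ n : ℕ, d ≤ n → n < 2 ^ d →
      ENNReal.ofReal (0.27 * ((n : ℝ) + 1) ^ (-MixedSobolev.lowerExponent d (n + 1))) ≤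
        MixedSobolev.mixedMinimalError 𝕜 a b d r n ∧
      MixedSobolev.lowerExponent d (n + 1) ≤ 1.17) :=
  ⟨MixedSobolev.mixedMinimalError_le_rpow 𝕜 hab hd hr, fun _ hdn hn =>
    ⟨MixedSobolev.rpow_le_mixedMinimalError 𝕜 hab hd r hdn hn,
      MixedSobolev.lowerExponent_le (by omega) hn⟩⟩
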